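/- **Theorem 3.1.** Let $\operatorname{Im}\tau>0$, let $\theta_1(x)=\sum_{k\in\mathbb Z}\exp\bigl(\pi i\tau(k+\tfrac12)^2+2\pi i(x+\tfrac12)(k+\tfrac12)\bigr)$, let $\ell\ge 1$ be an integer, and let $\eta\in\mathbb C$ be generic in the sense that $\theta_1(2j\eta)\neq0$ for $1\le j\le 2\ell$. Put $[j]=\theta_1(2j\eta)$, $[n]!=\prod_{j=1}^n[j]$, $\left[{n\atop m}\right]=\frac{[n]!}{[m]!\,[n-m]!}$, and $\Phi(x,\zeta)=\frac{\theta_1(\zeta+x)}{\theta_1(x)\theta_1(\zeta)}$. For an integer $j$ with $|j|\le\ell$ put $s=\ell-|j|$ and $$A_{j\eta}(E)=\left[{\ell\atop s}\right]\left[{2\ell\atop s}\right]^{-1}\det\left(E\,\delta_{a,b}+\frac{[-a]}{[\ell+1-a]}\,\delta_{a,b-1}+\frac{[2\ell+2-a]}{[\ell+1-a]}\,\delta_{a,b+1}\right)_{1\le a,b\le s}.$$ (i) Let $\zeta,K,E\in\mathbb C$ with $\theta_1(\zeta)\ne0$ and $K\neq0$, and fix any logarithm $\kappa$ of $K$, with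 $K^{y}:=e^{\kappa y}$. The difference Lamé equation $$\psi(x+\eta)+\frac{\theta_1(2x+2\ell\eta)\,\theta_1(2x-2(\ell+1)\eta)}{\theta_1(2x)\,\theta_1(2x-2\eta)}\,\psi(x-\eta)=E\,\psi(x)$$ has a not identically zero meromorphic solution of the form $$\psi(x)=K^{x/\eta}\sum_{j=1}^{\ell}s_j\,\Phi(2x-2j\eta,\zeta),\qquad s_j\in\mathbb C,$$ which is double-Bloch, $\psi(x+\tfrac12)=K^{1/(2\eta)}\psi(x)$ and $\psi(x+\tfrac\tau2)=K^{\tau/(2\eta)}e^{-2\pi i\zeta}\psi(x)$, if and only if $$\sum_{j=0}^{\ell}(-1)^jK^{-j}\,\theta_1(\zeta-2j\eta)\left[{\ell\atop j}\right]A_{j\eta}(E)=0,$$ $$\sum_{j=0}^{\ell+1}(-1)^jK^{-j}\,\theta_1(\zeta-2j\eta)\,\theta_1(2(j-1)\eta)\left[{\ell+1\atop j}\right]A_{(j-1)\eta}(E)=0.$$ (ii) For $|j|\le\ell$, $A_{j\eta}(E)$ is a polynomial in $E$ of degree exactly $\ell-|j|$. (iii) For $\lambda\in\mathbb C$ let $A_\lambda=\sum_{k=0}^{\ell}A_k(x,\lambda)\,e^{(2k\eta-\ell\eta+\lambda)\partial_x}$,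 where $(e^{c\,\partial_x}F)(x)=F(x+c)$ and $$A_k(x,\lambda)=(-1)^k\frac{[\ell]!}{[2\ell]!}\left[{\ell\atop k}\right]\prod_{j=0}^{\ell-k-1}\frac{\theta_1(2x+2(\ell-j)\eta)\,\theta_1(2\lambda+2(\ell-j)\eta)}{\theta_1(2x+2\lambda+2(k-j)\eta)}\prod_{j=0}^{k-1}\frac{\theta_1(2x-2(\ell-j)\eta)\,\theta_1(2\lambda-2(\ell-j)\eta)}{\theta_1(2x+2\lambda+2(k+j-\ell)\eta)},$$ and let $L=\frac{\theta_1(2x-2\ell\eta)}{\theta_1(2x)}e^{\eta\partial_x}+\frac{\theta_1(2x+2\ell\eta)}{\theta_1(2x)}e^{-\eta\partial_x}$. The operators $A_{j\eta}$, $j\in\mathbb Z$, $|j|\le\ell$, commute with each other, and the values $A_{j\eta}(E)$ are their eigenvalues: if $L\Psi=E\Psi$, then $A_{j\eta}\Psi=A_{j\eta}(E)\,\Psi$ for all $|j|\le\ell$. (Here the operators act on functions $\mathbb C\to\mathbb C$, in particular on meromorphic ones, and equality means equality off a closed discrete set.) -/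

import Mathlib

open Filter Polynomial

noncomputable section

namespace DifferenceLame

/-- The odd Jacobi theta function
`θ₁(x|τ) = ∑_{k ∈ ℤ} exp(π i τ (k + 1/2)² + 2 π i (x + 1/2)(k + 1/2))`. -/
def theta1 (τ x : ℂ) : ℂ :=
  ∑' k : ℤ, Complex.exp (Real.pi * Complex.I * τ * ((k : ℂ) + 1 / 2) ^ 2
    + 2 * Real.pi * Complex.I * (x + 1 / 2) * ((k : ℂ) + 1 / 2))

/-- The elliptic number `[n] = θ₁(2 n η)`. -/
def ellNum (τ η : ℂ) (n : ℤ) : ℂ := theta1 τ (2 * n * η)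

/-- The elliptic factorial `[n]! = [1][2]⋯[n]`. -/
def ellFactorial (τ η : ℂ) (n : ℕ) : ℂ := ∏ j ∈ Finset.Icc 1 n, ellNum τ η j

/-- The elliptic binomial coefficient `[n]! / ([m]! [n-m]!)` (used for `m ≤ n` only). -/
def ellBinom (τ η : ℂ) (n m : ℕ) : ℂ :=
  ellFactorial τ η n / (ellFactorial τ η m * ellFactorial τ η (n - m))

/-- The `s × s` tridiagonal matrix, with rows and columns numbered from `1` to `s`, with entries
`E δ_{i,j} + [-i]/[ℓ+1-i] δ_{i,j-1} + [2ℓ+2-i]/[ℓ+1-i] δ_{i,j+1}`, where `E` is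
the polynomial variable. -/
def lameMatrix (τ η : ℂ) (ℓ s : ℕ) : Matrix (Fin s) (Fin s) ℂ[X] :=
  Matrix.of fun a b =>
    let i : ℤ := (a : ℕ) + 1
    let j : ℤ := (b : ℕ) + 1
    (if i = j then X else 0)
      + (if i = j - 1 then C (ellNum τ η (-i) / ellNum τ η (ℓ + 1 - i)) else 0)
      + (if i = j + 1 then C (ellNum τ η (2 * ℓ + 2 - i) / ellNum τ η (ℓ + 1 - i)) else 0)

/-- The polynomial `A_{jη}(E)` for integers `|j| ≤ ℓ`: with `s = ℓ - |j|` it is the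
determinant of `lameMatrix` of size `s` times a quotient of elliptic binomials.
In particular `A_{-jη}(E) = A_{jη}(E)`. -/
def lamePoly (τ η : ℂ) (ℓ : ℕ) (j : ℤ) : ℂ[X] :=
  C (ellBinom τ η ℓ (ℓ - j.natAbs) * (ellBinom τ η (2 * ℓ) (ℓ - j.natAbs))⁻¹)
    * (lameMatrix τ η ℓ (ℓ - j.natAbs)).det

/-- The function `Φ(x, ζ) = θ₁(ζ + x) / (θ₁(x) θ₁(ζ))`. -/
def Phi (τ x ζ : ℂ) : ℂ := theta1 τ (ζ + x) / (theta1 τ x * theta1 τ ζ)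

/-- A double-Bloch function with multipliers `B₁` and `Bτ`: a meromorphic function with
`ψ(x + 1/2) = B₁ ψ(x)` and `ψ(x + τ/2) = Bτ ψ(x)`. Here and below, equality of meromorphic
functions is equality off a closed discrete set of points. -/
def IsDoubleBloch (τ B₁ Bτ : ℂ) (ψ : ℂ → ℂ) : Prop :=
  Meromorphic ψ ∧
  (fun x => ψ (x + 1 / 2)) =ᶠ[codiscrete ℂ] (fun x => B₁ * ψ x) ∧
  (fun x => ψ (x + τ / 2)) =ᶠ[codiscrete ℂ] (fun x => Bτ * ψ x)

/-- The ansatz `ψ(x) = K^{x/η} ∑_{j=1}^{ℓ} s_j Φ(2x - 2jη, ζ)`, where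
`K^y = exp(κ y)` is the branch given by a logarithm `κ` of `K`. -/
def blochAnsatz (τ η ζ κ : ℂ) (ℓ : ℕ) (s : ℕ → ℂ) (x : ℂ) : ℂ :=
  Complex.exp (κ * (x / η)) * ∑ j ∈ Finset.Icc 1 ℓ, s j * Phi τ (2 * x - 2 * j * η) ζ

/-- The difference Lamé equation
`ψ(x+η) + θ₁(2x+2ℓη) θ₁(2x-2(ℓ+1)η) / (θ₁(2x) θ₁(2x-2η)) ψ(x-η) = E ψ(x)`. -/
def SolvesLame (τ η : ℂ) (ℓ : ℕ) (E : ℂ) (ψ : ℂ → ℂ) : Prop :=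
  (fun x => ψ (x + η)
      + theta1 τ (2 * x + 2 * ℓ * η) * theta1 τ (2 * x - 2 * (ℓ + 1) * η)
        / (theta1 τ (2 * x) * theta1 τ (2 * x - 2 * η)) * ψ (x - η))
    =ᶠ[codiscrete ℂ] (fun x => E * ψ x)

/-- The difference Lamé operator
`L = θ₁(2x-2ℓη)/θ₁(2x) e^{η∂ₓ} + θ₁(2x+2ℓη)/θ₁(2x) e^{-η∂ₓ}`. -/
def lameOp (τ η : ℂ) (ℓ : ℕ) (F : ℂ → ℂ) : ℂ → ℂ := fun x =>
  theta1 τ (2 * x - 2 * ℓ * η) / theta1 τ (2 * x) * F (x + η)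
    + theta1 τ (2 * x + 2 * ℓ * η) / theta1 τ (2 * x) * F (x - η)

/-- The coefficient `A_k(x, lam)` of the operator `A_lam`, for `0 ≤ k ≤ ℓ`. -/
def coeffA (τ η : ℂ) (ℓ k : ℕ) (x lam : ℂ) : ℂ :=
  (-1) ^ k * (ellFactorial τ η ℓ / ellFactorial τ η (2 * ℓ)) * ellBinom τ η ℓ k
    * (∏ j ∈ Finset.range (ℓ - k),
        theta1 τ (2 * x + 2 * ((ℓ : ℂ) - j) * η) * theta1 τ (2 * lam + 2 * ((ℓ : ℂ) - j) * η)
          / theta1 τ (2 * x + 2 * lam + 2 * ((k : ℂ) - j) * η))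
    * (∏ j ∈ Finset.range k,
        theta1 τ (2 * x - 2 * ((ℓ : ℂ) - j) * η) * theta1 τ (2 * lam - 2 * ((ℓ : ℂ) - j) * η)
          / theta1 τ (2 * x + 2 * lam + 2 * ((k : ℂ) + j - ℓ) * η))

/-- The difference operator `A_lam = ∑_{k=0}^{ℓ} A_k(x, lam) e^{(2kη - ℓη + lam)∂ₓ}`. -/
def opA (τ η : ℂ) (ℓ : ℕ) (lam : ℂ) (F : ℂ → ℂ) : ℂ → ℂ := fun x =>
  ∑ k ∈ Finset.range (ℓ + 1),
    coeffA τ η ℓ k x lam * F (x + (2 * k * η - ℓ * η + lam))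

end DifferenceLame

end

open DifferenceLame

namespace DifferenceLame

open Complex Topology

/-! ### The theta function -/

section Theta

variable {τ : ℂ}

/-! Everything rests on Weierstrass' three-term identity `theta1_three_term`. It holds because θ₁(x
+ y) θ₁(x - y) is an antisymmetric expression e(x) o(y) - o(x) e(y) in two functions.

Operators. Applied to the coefficients, the identity gives the exchange relation (`lameOp_opA`)
θ₁(2λ) L A_λ = θ₁(2λ + 2ℓη) A_{λ-η} + θ₁(2λ - 2ℓη) A_{λ+η}. At λ = jη its coefficients are [j],
[j+ℓ], [j-ℓ]. Since A_{ℓη} is the identity (`opA_self`) and [j-ℓ] vanishes at j = ℓ, the relation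
determines all A_{jη} downwards as polynomials in L. Expansion of the tridiagonal determinants gives
the same recursion for the polynomials A_{jη}(E) (`lamePoly_recurrence`), so A_{jη} is the value of
A_{jη}(E) at E = L (`opA_eventuallyEq_aeval`). Commutation and the eigenvalues follow at once. The
degree is read off from the determinants, which are monic.

Spectral curve. The ansatz is double-Bloch by the quasi-periodicity of θ₁. Two further three-term
identities expand the potential times Φ into functions Φ(2x - 2iη, ζ) (`potential_mul_Phi`), which
are linearly independent (`eq_zero_of_sum_Phi`). The Lamé equation thus becomes ℓ + 1 linear
equations for s_1, ..., s_ℓ. Those of index i ≥ 2 form a three-term recursion that fixes the s_j up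
to a common factor, and the recursion of the A_{jη}(E) shows that s_j = (-1)^j K^{-j} [j] [ℓ over j]
A_{jη}(E) solves it. The equations i = 1 and i = 0 are then, up to nonzero factors, the two
equations of the curve. -/

lemma theta1_eq_jacobiTheta₂ (τ x : ℂ) :
    theta1 τ x = cexp (Real.pi * I * τ / 4 + Real.pi * I * (x + 1 / 2))
      * jacobiTheta₂ (x + 1 / 2 + τ / 2) τ := by
  rw [theta1, jacobiTheta₂, ← tsum_mul_left]
  refine tsum_congr fun k => ?_
  rw [jacobiTheta₂_term, ← Complex.exp_add]
  ring_nf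

lemma differentiable_theta1 (hτ : 0 < τ.im) : Differentiable ℂ (theta1 τ) := by
  have h : theta1 τ = fun x => cexp (Real.pi * I * τ / 4 + Real.pi * I * (x + 1 / 2))
      * jacobiTheta₂ (x + 1 / 2 + τ / 2) τ := funext (theta1_eq_jacobiTheta₂ τ)
  rw [h]
  refine Differentiable.mul (by fun_prop) fun x => ?_
  exact (differentiableAt_jacobiTheta₂_fst (x + 1 / 2 + τ / 2) hτ).comp x
    (f := fun x => x + 1 / 2 + τ / 2) (by fun_prop)

lemma theta1_add_one (τ x : ℂ) : theta1 τ (x + 1) = -theta1 τ x := by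
  rw [theta1_eq_jacobiTheta₂, theta1_eq_jacobiTheta₂ τ x,
    show x + 1 + 1 / 2 + τ / 2 = x + 1 / 2 + τ / 2 + 1 by ring, jacobiTheta₂_add_left,
    show (Real.pi * I * τ / 4 + Real.pi * I * (x + 1 + 1 / 2) : ℂ)
      = Real.pi * I * τ / 4 + Real.pi * I * (x + 1 / 2) + Real.pi * I by ring,
    Complex.exp_add _ (Real.pi * I), Complex.exp_pi_mul_I]
  ring

lemma theta1_add_tau (τ x : ℂ) :
    theta1 τ (x + τ) = -(cexp (-Real.pi * I * τ - 2 * Real.pi * I * x) * theta1 τ x) := by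
  rw [theta1_eq_jacobiTheta₂, theta1_eq_jacobiTheta₂ τ x,
    show x + τ + 1 / 2 + τ / 2 = x + 1 / 2 + τ / 2 + τ by ring, jacobiTheta₂_add_left',
    ← mul_assoc, ← mul_assoc, ← neg_mul]
  congr 1
  rw [← Complex.exp_add, ← Complex.exp_add, neg_eq_neg_one_mul (cexp _), ← Complex.exp_pi_mul_I,
    ← Complex.exp_add, Complex.exp_eq_exp_iff_exists_int]
  exact ⟨-1, by push_cast; ring⟩

/-- The sum of the terms of even index `m` of the series `∑ exp(π i τ m²/2 + 2 π i m x)`. -/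
noncomputable def thetaEven (τ x : ℂ) : ℂ :=
  ∑' p : ℤ, cexp (2 * Real.pi * I * τ * (p : ℂ) ^ 2 + 4 * Real.pi * I * x * p)

/-- The sum of the terms of odd index `m` of the series `∑ exp(π i τ m²/2 + 2 π i m x)`. -/
noncomputable def thetaOdd (τ x : ℂ) : ℂ :=
  ∑' p : ℤ, cexp (Real.pi * I * τ * (2 * (p : ℂ) + 1) ^ 2 / 2
    + 2 * Real.pi * I * x * (2 * p + 1))

lemma summable_norm_theta1_term (hτ : 0 < τ.im) (x : ℂ) :
    Summable fun k : ℤ => ‖cexp (Real.pi * I * τ * ((k : ℂ) + 1 / 2) ^ 2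
      + 2 * Real.pi * I * (x + 1 / 2) * ((k : ℂ) + 1 / 2))‖ := by
  have h := ((summable_jacobiTheta₂_term_iff (x + 1 / 2 + τ / 2) τ).2 hτ).norm.mul_left
    ‖cexp (Real.pi * I * τ / 4 + Real.pi * I * (x + 1 / 2))‖
  refine h.congr fun k => ?_
  rw [jacobiTheta₂_term, ← norm_mul, ← Complex.exp_add]
  ring_nf

lemma summable_norm_thetaEven_term (hτ : 0 < τ.im) (x : ℂ) :
    Summable fun p : ℤ => ‖cexp (2 * Real.pi * I * τ * (p : ℂ) ^ 2
      + 4 * Real.pi * I * x * p)‖ := by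
  have h := ((summable_jacobiTheta₂_term_iff (2 * x) (2 * τ)).2 (by simpa using hτ)).norm
  refine h.congr fun k => ?_
  rw [jacobiTheta₂_term]
  ring_nf

lemma summable_norm_thetaOdd_term (hτ : 0 < τ.im) (x : ℂ) :
    Summable fun p : ℤ => ‖cexp (Real.pi * I * τ * (2 * (p : ℂ) + 1) ^ 2 / 2
      + 2 * Real.pi * I * x * (2 * p + 1))‖ := by
  have h := ((summable_jacobiTheta₂_term_iff (2 * x + τ) (2 * τ)).2
    (by simpa using hτ)).norm.mul_left ‖cexp (Real.pi * I * τ / 2 + 2 * Real.pi * I * x)‖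
  refine h.congr fun k => ?_
  rw [jacobiTheta₂_term, ← norm_mul, ← Complex.exp_add]
  ring_nf

/-- The pairs `(k, l)` of integers, split by the parity of `k - l`: the pairs `(p + q, p - q - 1)`
and the pairs `(p + q, p - q)`. -/
def parityEquiv : (ℤ × ℤ) ⊕ (ℤ × ℤ) ≃ ℤ × ℤ where
  toFun := Sum.elim (fun a => (a.1 + a.2, a.1 - a.2 - 1)) (fun a => (a.1 + a.2, a.1 - a.2))
  invFun b := if (b.1 - b.2) % 2 = 1 then Sum.inl ((b.1 + b.2 + 1) / 2, (b.1 - b.2 - 1) / 2)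
    else Sum.inr ((b.1 + b.2) / 2, (b.1 - b.2) / 2)
  left_inv := by
    rintro (⟨p, q⟩ | ⟨p, q⟩)
    · have h : (p + q - (p - q - 1)) % 2 = 1 := by lia
      simp only [Sum.elim_inl, h, if_true, Sum.inl.injEq, Prod.mk.injEq]
      lia
    · have h : ¬ (p + q - (p - q)) % 2 = 1 := by lia
      simp only [Sum.elim_inr, h, if_false, Sum.inr.injEq, Prod.mk.injEq]
      lia
  right_inv := by
    rintro ⟨k, l⟩
    by_cases h : (k - l) % 2 = 1
    · simp only [h, if_true, Sum.elim_inl, Prod.mk.injEq]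
      lia
    · simp only [h, if_false, Sum.elim_inr, Prod.mk.injEq]
      lia

/-- The addition formula `θ₁(x + y) θ₁(x - y) = e(x) o(y) - o(x) e(y)`. -/
lemma theta1_add_mul_theta1_sub (hτ : 0 < τ.im) (x y : ℂ) :
    theta1 τ (x + y) * theta1 τ (x - y)
      = thetaEven τ x * thetaOdd τ y - thetaOdd τ x * thetaEven τ y := by
  have hs₁ := summable_norm_theta1_term hτ (x + y)
  have hs₂ := summable_norm_theta1_term hτ (x - y)
  have he := summable_norm_thetaEven_term hτ
  have ho := summable_norm_thetaOdd_term hτ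
  have hs := summable_mul_of_summable_norm hs₁ hs₂
  rw [← parityEquiv.summable_iff] at hs
  rw [theta1, theta1, tsum_mul_tsum_of_summable_norm hs₁ hs₂, ← parityEquiv.tsum_eq]
  refine (Summable.tsum_sum (hs.comp_injective Sum.inl_injective)
    (hs.comp_injective Sum.inr_injective)).trans ?_
  rw [sub_eq_add_neg (thetaEven τ x * thetaOdd τ y), thetaEven, thetaOdd, thetaOdd, thetaEven, tsum_mul_tsum_of_summable_norm (he x) (ho y),
    tsum_mul_tsum_of_summable_norm (ho x) (he y), ← tsum_neg]
  congr 1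
  -- The exponent is governed by x(k + l + 1) + y(k - l), and the half-period shift contributes the
  -- phase exp(πi(k + l + 1)). Here k + l + 1 = 2p and the phase is 1; in the other half it is 2p +
  -- 1, whence the minus sign.
  · refine tsum_congr fun ⟨p, q⟩ => ?_
    simp only [Function.comp_apply, parityEquiv, Equiv.coe_fn_mk, Sum.elim_inl]
    rw [← Complex.exp_add, ← Complex.exp_add, Complex.exp_eq_exp_iff_exists_int]
    exact ⟨p, by push_cast; ring⟩
  · refine tsum_congr fun ⟨p, q⟩ => ?_
    simp only [Function.comp_apply, parityEquiv, Equiv.coe_fn_mk, Sum.elim_inr]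
    rw [← Complex.exp_add, ← Complex.exp_add, neg_eq_neg_one_mul (cexp _), ← Complex.exp_pi_mul_I,
      ← Complex.exp_add, Complex.exp_eq_exp_iff_exists_int]
    exact ⟨p, by push_cast; ring⟩

/-- The right side of the addition formula is antisymmetric. The pairs (0, x) and (x, 0) give θ₁(x)
θ₁(-x) = -θ₁(x)²; with the same relation at -x, the square of θ₁(x) + θ₁(-x) vanishes. -/
lemma theta1_neg (hτ : 0 < τ.im) (x : ℂ) : theta1 τ (-x) = -theta1 τ x := by
  have h₁ : theta1 τ x * theta1 τ (-x) = -(theta1 τ x * theta1 τ x) := by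
    have h₁ := theta1_add_mul_theta1_sub hτ 0 x
    have h₂ := theta1_add_mul_theta1_sub hτ x 0
    simp only [zero_add, add_zero, zero_sub, sub_zero] at h₁ h₂
    rw [h₁, h₂]
    ring
  have h₂ : theta1 τ (-x) * theta1 τ x = -(theta1 τ (-x) * theta1 τ (-x)) := by
    have h₁ := theta1_add_mul_theta1_sub hτ 0 (-x)
    have h₂ := theta1_add_mul_theta1_sub hτ (-x) 0
    simp only [zero_add, add_zero, zero_sub, sub_zero, neg_neg] at h₁ h₂
    rw [h₁, h₂]
    ring
  have h₃ : (theta1 τ x + theta1 τ (-x)) ^ 2 = 0 := by linear_combination h₁ + h₂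
  linear_combination pow_eq_zero_iff (two_ne_zero) |>.1 h₃

lemma theta1_zero (hτ : 0 < τ.im) : theta1 τ 0 = 0 := by
  have h := theta1_neg hτ 0
  rw [neg_zero] at h
  exact self_eq_neg.1 h

/-- Weierstrass' three-term identity. -/
lemma theta1_three_term (hτ : 0 < τ.im) (x y z w : ℂ) :
    theta1 τ (x + y) * theta1 τ (x - y) * (theta1 τ (z + w) * theta1 τ (z - w))
      - theta1 τ (x + z) * theta1 τ (x - z) * (theta1 τ (y + w) * theta1 τ (y - w))
      + theta1 τ (x + w) * theta1 τ (x - w) * (theta1 τ (y + z) * theta1 τ (y - z)) = 0 := by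
  -- Each product becomes a 2 × 2 minor of the matrix with rows e and o; the claim is the Plücker
  -- relation.
  simp only [theta1_add_mul_theta1_sub hτ]
  ring

/-- A function `x ↦ θ₁(a x + b)` with `a ≠ 0` has a closed discrete zero set as soon as `θ₁` is not
identically zero. -/
lemma eventually_theta1_ne_zero (hτ : 0 < τ.im) {u : ℂ} (hu : theta1 τ u ≠ 0) {a : ℂ} (ha : a ≠ 0)
    (b : ℂ) : ∀ᶠ x in codiscrete ℂ, theta1 τ (a * x + b) ≠ 0 := by
  have han : AnalyticOnNhd ℂ (fun x => theta1 τ (a * x + b)) Set.univ := by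
    refine DifferentiableOn.analyticOnNhd ?_ isOpen_univ
    exact ((differentiable_theta1 hτ).comp (f := fun x => a * x + b)
      (by fun_prop)).differentiableOn
  have h := han.preimage_zero_mem_codiscrete (x := (u - b) / a)
    (by simpa [mul_div_cancel₀ _ ha] using hu)
  filter_upwards [h] with x hx
  simpa using hx

end Theta

/-! ### Elliptic factorials and the coefficients of A_λ -/

section Coefficients

variable {τ η : ℂ} {ℓ : ℕ}

lemma ellNum_neg (hτ : 0 < τ.im) (n : ℤ) : ellNum τ η (-n) = -ellNum τ η n := by
  rw [ellNum, ellNum, ← theta1_neg hτ]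
  push_cast
  ring_nf

lemma ellNum_zero (hτ : 0 < τ.im) : ellNum τ η 0 = 0 := by
  simp [ellNum, theta1_zero hτ]

lemma ellFactorial_zero (τ η : ℂ) : ellFactorial τ η 0 = 1 := by
  simp [ellFactorial]

lemma ellFactorial_succ (τ η : ℂ) (n : ℕ) :
    ellFactorial τ η (n + 1) = ellFactorial τ η n * ellNum τ η (n + 1) := by
  rw [ellFactorial, Finset.prod_Icc_succ_top (by lia), ellFactorial]
  push_cast
  rfl

lemma ellFactorial_ne_zero {N n : ℕ} (hη : ∀ j : ℕ, 1 ≤ j → j ≤ N → ellNum τ η j ≠ 0)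
    (hn : n ≤ N) : ellFactorial τ η n ≠ 0 := by
  rw [ellFactorial, Finset.prod_ne_zero_iff]
  intro j hj
  rw [Finset.mem_Icc] at hj
  exact hη j hj.1 (hj.2.trans hn)

/-- The constant factor of `coeffA`. -/
noncomputable def constA (τ η : ℂ) (ℓ k : ℕ) : ℂ :=
  (-1) ^ k * (ellFactorial τ η ℓ / ellFactorial τ η (2 * ℓ)) * ellBinom τ η ℓ k

/-- The product `∏_{j < n} θ₁(u + 2(ℓ - j)η)`. -/
noncomputable def plusProd (τ η : ℂ) (ℓ n : ℕ) (u : ℂ) : ℂ :=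
  ∏ j ∈ Finset.range n, theta1 τ (u + 2 * ((ℓ : ℂ) - j) * η)

/-- The product `∏_{j < k} θ₁(u - 2(ℓ - j)η)`. -/
noncomputable def minusProd (τ η : ℂ) (ℓ k : ℕ) (u : ℂ) : ℂ :=
  ∏ j ∈ Finset.range k, theta1 τ (u - 2 * ((ℓ : ℂ) - j) * η)

lemma coeffA_eq (τ η : ℂ) (ℓ k : ℕ) (x lam : ℂ) :
    coeffA τ η ℓ k x lam = constA τ η ℓ k
      * (plusProd τ η ℓ (ℓ - k) (2 * x) * plusProd τ η ℓ (ℓ - k) (2 * lam)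
        / ∏ j ∈ Finset.range (ℓ - k), theta1 τ (2 * x + 2 * lam + 2 * ((k : ℂ) - j) * η))
      * (minusProd τ η ℓ k (2 * x) * minusProd τ η ℓ k (2 * lam)
        / ∏ j ∈ Finset.range k, theta1 τ (2 * x + 2 * lam + 2 * ((k : ℂ) + j - ℓ) * η)) := by
  simp only [coeffA, constA, plusProd, minusProd, Finset.prod_div_distrib, Finset.prod_mul_distrib]

lemma coeffA_comm (τ η : ℂ) (ℓ k : ℕ) (x lam : ℂ) :
    coeffA τ η ℓ k x lam = coeffA τ η ℓ k lam x := by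
  rw [coeffA_eq, coeffA_eq, add_comm (2 * x), mul_comm (plusProd τ η ℓ (ℓ - k) (2 * x)),
    mul_comm (minusProd τ η ℓ k (2 * x))]

lemma plusProd_succ (τ η : ℂ) (ℓ n : ℕ) (u : ℂ) :
    plusProd τ η ℓ (n + 1) u = plusProd τ η ℓ n u * theta1 τ (u + 2 * ((ℓ : ℂ) - n) * η) :=
  Finset.prod_range_succ _ _

/-- Splitting off the first factor instead of the last shifts the argument. Equating the two
splittings compares the products at u and u - 2η without dividing by a factor that might vanish. -/
lemma plusProd_succ' (τ η : ℂ) (ℓ n : ℕ) (u : ℂ) :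
    plusProd τ η ℓ (n + 1) u = plusProd τ η ℓ n (u - 2 * η) * theta1 τ (u + 2 * ℓ * η) := by
  rw [plusProd, plusProd, Finset.prod_range_succ']
  congr 1
  · exact Finset.prod_congr rfl fun j _ => by push_cast; ring_nf
  · simp

lemma minusProd_succ (τ η : ℂ) (ℓ k : ℕ) (u : ℂ) :
    minusProd τ η ℓ (k + 1) u = minusProd τ η ℓ k u * theta1 τ (u - 2 * ((ℓ : ℂ) - k) * η) :=
  Finset.prod_range_succ _ _

lemma minusProd_succ' (τ η : ℂ) (ℓ k : ℕ) (u : ℂ) :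
    minusProd τ η ℓ (k + 1) u = minusProd τ η ℓ k (u + 2 * η) * theta1 τ (u - 2 * ℓ * η) := by
  rw [minusProd, minusProd, Finset.prod_range_succ']
  congr 1
  · exact Finset.prod_congr rfl fun j _ => by push_cast; ring_nf
  · simp

/-- The common factor of the coefficients in `theta1_mul_coeffA_succ_sub` and
`theta1_mul_coeffA_add`. -/
noncomputable def coeffCore (τ η : ℂ) (ℓ n k : ℕ) (x lam : ℂ) : ℂ :=
  plusProd τ η ℓ n (2 * x) * plusProd τ η ℓ n (2 * lam)
    * (minusProd τ η ℓ k (2 * x) * minusProd τ η ℓ k (2 * lam))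
    / ((∏ j ∈ Finset.range n, theta1 τ (2 * x + 2 * lam + 2 * ((k : ℂ) - j) * η))
      * ∏ j ∈ Finset.range k, theta1 τ (2 * x + 2 * lam + 2 * ((k : ℂ) + 1 + j - ℓ) * η))

lemma coeffCore_comm (τ η : ℂ) (ℓ n k : ℕ) (x lam : ℂ) :
    coeffCore τ η ℓ n k x lam = coeffCore τ η ℓ n k lam x := by
  rw [coeffCore, coeffCore, add_comm (2 * x), mul_comm (plusProd τ η ℓ n (2 * x)),
    mul_comm (minusProd τ η ℓ k (2 * x))]

/-- The coefficient of L supplies the factor missing from the shifted product. As `coeffCore` and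
`coeffA` are symmetric in x and λ, this lemma and the next also give, with x and λ exchanged, the
coefficients at λ ∓ η; all four terms of `coeffA_exchange` thereby share a factor. -/
lemma theta1_mul_coeffA_succ_sub {n k : ℕ} (h : ℓ = n + k + 1) (x lam : ℂ) :
    theta1 τ (2 * x + 2 * ℓ * η) * coeffA τ η ℓ (k + 1) (x - η) lam
      = constA τ η ℓ (k + 1) * coeffCore τ η ℓ n k x lam
        * (theta1 τ (2 * x + 2 * (k + 1) * η) * theta1 τ (2 * x - 2 * (ℓ + 1) * η)
          * theta1 τ (2 * lam - 2 * ((ℓ : ℂ) - k) * η))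
        / theta1 τ (2 * x + 2 * lam + 2 * ((k : ℂ) - ℓ) * η) := by
  have hc : (ℓ : ℂ) = n + k + 1 := by rw [h]; push_cast; ring
  have hn : ℓ - (k + 1) = n := by lia
  have h₁ := (plusProd_succ' τ η ℓ n (2 * x)).symm.trans (plusProd_succ τ η ℓ n (2 * x))
  rw [show (2 * x + 2 * ((ℓ : ℂ) - n) * η) = 2 * x + 2 * (k + 1) * η by rw [hc]; ring] at h₁
  have h₂ := minusProd_succ' τ η ℓ k (2 * x - 2 * η)
  rw [sub_add_cancel, show 2 * x - 2 * η - 2 * ℓ * η = 2 * x - 2 * (ℓ + 1) * η by ring] at h₂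
  have h₃ : ∏ j ∈ Finset.range n, theta1 τ (2 * (x - η) + 2 * lam + 2 * (((k + 1 : ℕ) : ℂ) - j) * η)
      = ∏ j ∈ Finset.range n, theta1 τ (2 * x + 2 * lam + 2 * ((k : ℂ) - j) * η) :=
    Finset.prod_congr rfl fun j _ => by push_cast; ring_nf
  have h₄ : ∏ j ∈ Finset.range (k + 1),
        theta1 τ (2 * (x - η) + 2 * lam + 2 * (((k + 1 : ℕ) : ℂ) + j - ℓ) * η)
      = (∏ j ∈ Finset.range k, theta1 τ (2 * x + 2 * lam + 2 * ((k : ℂ) + 1 + j - ℓ) * η))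
        * theta1 τ (2 * x + 2 * lam + 2 * ((k : ℂ) - ℓ) * η) := by
    rw [Finset.prod_range_succ']
    congr 1
    · exact Finset.prod_congr rfl fun j _ => by push_cast; ring_nf
    · push_cast; ring_nf
  rw [coeffA_eq, hn, h₃, h₄, coeffCore, mul_sub 2 x η, h₂, minusProd_succ τ η ℓ k (2 * lam)]
  simp only [div_eq_mul_inv, mul_inv]
  linear_combination constA τ η ℓ (k + 1) * plusProd τ η ℓ n (2 * lam)
    * (∏ j ∈ Finset.range n, theta1 τ (2 * x + 2 * lam + 2 * ((k : ℂ) - j) * η))⁻¹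
    * (minusProd τ η ℓ k (2 * x) * theta1 τ (2 * x - 2 * (ℓ + 1) * η)
      * (minusProd τ η ℓ k (2 * lam) * theta1 τ (2 * lam - 2 * ((ℓ : ℂ) - k) * η)))
    * ((∏ j ∈ Finset.range k, theta1 τ (2 * x + 2 * lam + 2 * ((k : ℂ) + 1 + j - ℓ) * η))⁻¹
      * (theta1 τ (2 * x + 2 * lam + 2 * ((k : ℂ) - ℓ) * η))⁻¹) * h₁

lemma theta1_mul_coeffA_add {n k : ℕ} (h : ℓ = n + k + 1) (x lam : ℂ) :
    theta1 τ (2 * x - 2 * ℓ * η) * coeffA τ η ℓ k (x + η) lam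
      = constA τ η ℓ k * coeffCore τ η ℓ n k x lam
        * (theta1 τ (2 * x + 2 * (ℓ + 1) * η) * theta1 τ (2 * x - 2 * ((ℓ : ℂ) - k) * η)
          * theta1 τ (2 * lam + 2 * (k + 1) * η))
        / theta1 τ (2 * x + 2 * lam + 2 * (k + 1) * η) := by
  have hc : (ℓ : ℂ) = n + k + 1 := by rw [h]; push_cast; ring
  have hn : ℓ - k = n + 1 := by lia
  have h₁ := (minusProd_succ' τ η ℓ k (2 * x)).symm.trans (minusProd_succ τ η ℓ k (2 * x))
  have h₂ := plusProd_succ' τ η ℓ n (2 * x + 2 * η)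
  rw [add_sub_cancel_right, show 2 * x + 2 * η + 2 * ℓ * η = 2 * x + 2 * (ℓ + 1) * η by ring] at h₂
  have h₃ := plusProd_succ τ η ℓ n (2 * lam)
  rw [show (2 * lam + 2 * ((ℓ : ℂ) - n) * η) = 2 * lam + 2 * (k + 1) * η by rw [hc]; ring] at h₃
  have h₄ : ∏ j ∈ Finset.range (n + 1), theta1 τ (2 * (x + η) + 2 * lam + 2 * ((k : ℂ) - j) * η)
      = (∏ j ∈ Finset.range n, theta1 τ (2 * x + 2 * lam + 2 * ((k : ℂ) - j) * η))
        * theta1 τ (2 * x + 2 * lam + 2 * (k + 1) * η) := by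
    rw [Finset.prod_range_succ']
    congr 1
    · exact Finset.prod_congr rfl fun j _ => by push_cast; ring_nf
    · push_cast; ring_nf
  have h₅ : ∏ j ∈ Finset.range k, theta1 τ (2 * (x + η) + 2 * lam + 2 * ((k : ℂ) + j - ℓ) * η)
      = ∏ j ∈ Finset.range k, theta1 τ (2 * x + 2 * lam + 2 * ((k : ℂ) + 1 + j - ℓ) * η) :=
    Finset.prod_congr rfl fun j _ => by ring_nf
  rw [coeffA_eq, hn, h₄, h₅, coeffCore, mul_add 2 x η, h₂, h₃]
  simp only [div_eq_mul_inv, mul_inv]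
  linear_combination constA τ η ℓ k * (plusProd τ η ℓ n (2 * x)
      * theta1 τ (2 * x + 2 * (ℓ + 1) * η) * (plusProd τ η ℓ n (2 * lam)
      * theta1 τ (2 * lam + 2 * (k + 1) * η)))
    * (∏ j ∈ Finset.range n, theta1 τ (2 * x + 2 * lam + 2 * ((k : ℂ) - j) * η))⁻¹
    * (theta1 τ (2 * x + 2 * lam + 2 * (k + 1) * η))⁻¹ * minusProd τ η ℓ k (2 * lam)
    * (∏ j ∈ Finset.range k, theta1 τ (2 * x + 2 * lam + 2 * ((k : ℂ) + 1 + j - ℓ) * η))⁻¹ * h₁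

lemma constA_succ {k : ℕ} (hη : ∀ j : ℕ, 1 ≤ j → j ≤ ℓ → ellNum τ η j ≠ 0) (hk : k < ℓ) :
    constA τ η ℓ (k + 1) * theta1 τ (2 * (k + 1) * η)
      = -(constA τ η ℓ k * theta1 τ (2 * ((ℓ : ℂ) - k) * η)) := by
  obtain ⟨n, rfl⟩ : ∃ n, ℓ = n + k + 1 := ⟨ℓ - k - 1, by lia⟩
  have h₁ := ellFactorial_succ τ η n
  have h₂ := ellFactorial_succ τ η k
  have h₃ : ellNum τ η (n + 1) = theta1 τ (2 * (((n + k + 1 : ℕ) : ℂ) - k) * η) := by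
    rw [ellNum]; push_cast; ring_nf
  have h₄ : ellNum τ η (k + 1) = theta1 τ (2 * (k + 1) * η) := by
    rw [ellNum]; push_cast; ring_nf
  have h₅ := ellFactorial_ne_zero hη (n := n + 1) (by lia)
  have h₆ := ellFactorial_ne_zero hη (n := k + 1) (by lia)
  rw [constA, constA, ellBinom, ellBinom, show n + k + 1 - (k + 1) = n by lia,
    show n + k + 1 - k = n + 1 by lia, ← h₃, ← h₄]
  rw [h₁] at h₅ ⊢
  rw [h₂] at h₆ ⊢
  have := left_ne_zero_of_mul h₅
  have := right_ne_zero_of_mul h₅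
  have := left_ne_zero_of_mul h₆
  have := right_ne_zero_of_mul h₆
  -- The hypothesis stops at ℓ, so [2ℓ]! may vanish; both constants are then 0 by the convention for
  -- division.
  by_cases h₀ : ellFactorial τ η (2 * (n + k + 1)) = 0
  · simp [h₀]
  field_simp
  ring

/-- Comparison of the coefficients of `L A_lam` with those of `A_{lam - η}` and `A_{lam + η}`. -/
lemma coeffA_exchange (hτ : 0 < τ.im) (hη : ∀ j : ℕ, 1 ≤ j → j ≤ ℓ → ellNum τ η j ≠ 0)
    {k : ℕ} (hk : k < ℓ) {x lam : ℂ} (hx : theta1 τ (2 * x) ≠ 0)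
    (h₁ : theta1 τ (2 * x + 2 * lam + 2 * ((k : ℂ) - ℓ) * η) ≠ 0)
    (h₂ : theta1 τ (2 * x + 2 * lam + 2 * (k + 1) * η) ≠ 0) :
    theta1 τ (2 * lam) * (theta1 τ (2 * x - 2 * ℓ * η) / theta1 τ (2 * x)
        * coeffA τ η ℓ k (x + η) lam
      + theta1 τ (2 * x + 2 * ℓ * η) / theta1 τ (2 * x) * coeffA τ η ℓ (k + 1) (x - η) lam)
      = theta1 τ (2 * lam + 2 * ℓ * η) * coeffA τ η ℓ (k + 1) x (lam - η)
        + theta1 τ (2 * lam - 2 * ℓ * η) * coeffA τ η ℓ k x (lam + η) := by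
  obtain ⟨n, hn⟩ : ∃ n, ℓ = n + k + 1 := ⟨ℓ - k - 1, by lia⟩
  have e₁ := theta1_mul_coeffA_succ_sub (τ := τ) (η := η) hn x lam
  have e₂ := theta1_mul_coeffA_add (τ := τ) (η := η) hn x lam
  have e₃ := theta1_mul_coeffA_succ_sub (τ := τ) (η := η) hn lam x
  have e₄ := theta1_mul_coeffA_add (τ := τ) (η := η) hn lam x
  rw [coeffCore_comm, coeffA_comm, add_comm (2 * lam) (2 * x)] at e₃ e₄
  rw [e₃, e₄, div_mul_eq_mul_div, div_mul_eq_mul_div, e₁, e₂, ← add_div, ← mul_div_assoc,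
    div_eq_iff hx]
  have hc := constA_succ hη hk
  -- The terms with the constant of index k + 1 are two terms of the identity `w₁`, those with the
  -- constant of index k two terms of `w₂`. The leftover third terms both contain θ₁(2x - 2λ)
  -- θ₁(2(ℓ+1)η) and cancel by `constA_succ`.
  have w₁ := theta1_three_term hτ (2 * x + ((k : ℂ) - ℓ) * η) (2 * lam + ((k : ℂ) - ℓ) * η)
    ((k + ℓ + 2) * η) (((k : ℂ) - ℓ) * η)
  have w₂ := theta1_three_term hτ (2 * x + (k + 1) * η) (2 * lam + (k + 1) * η)
    ((2 * ℓ - k + 1) * η) ((k + 1) * η)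
  set a := (k : ℂ)
  set b := (ℓ : ℂ)
  rw [show 2 * x + (a - b) * η + (2 * lam + (a - b) * η) = 2 * x + 2 * lam + 2 * (a - b) * η by ring,
    show 2 * x + (a - b) * η - (2 * lam + (a - b) * η) = 2 * x - 2 * lam by ring,
    show (a + b + 2) * η + (a - b) * η = 2 * (a + 1) * η by ring,
    show (a + b + 2) * η - (a - b) * η = 2 * (b + 1) * η by ring,
    show 2 * x + (a - b) * η + (a + b + 2) * η = 2 * x + 2 * (a + 1) * η by ring,
    show 2 * x + (a - b) * η - (a + b + 2) * η = 2 * x - 2 * (b + 1) * η by ring,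
    show 2 * lam + (a - b) * η + (a + b + 2) * η = 2 * lam + 2 * (a + 1) * η by ring,
    show 2 * lam + (a - b) * η - (a + b + 2) * η = 2 * lam - 2 * (b + 1) * η by ring,
    show 2 * lam + (a - b) * η + (a - b) * η = 2 * lam - 2 * (b - a) * η by ring,
    show 2 * lam + (a - b) * η - (a - b) * η = 2 * lam by ring,
    show 2 * x + (a - b) * η + (a - b) * η = 2 * x - 2 * (b - a) * η by ring,
    show 2 * x + (a - b) * η - (a - b) * η = 2 * x by ring] at w₁
  rw [show 2 * x + (a + 1) * η + (2 * lam + (a + 1) * η)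
      = 2 * x + 2 * lam + 2 * (a + 1) * η by ring,
    show 2 * x + (a + 1) * η - (2 * lam + (a + 1) * η) = 2 * x - 2 * lam by ring,
    show (2 * b - a + 1) * η + (a + 1) * η = 2 * (b + 1) * η by ring,
    show (2 * b - a + 1) * η - (a + 1) * η = 2 * (b - a) * η by ring,
    show 2 * x + (a + 1) * η + (2 * b - a + 1) * η = 2 * x + 2 * (b + 1) * η by ring,
    show 2 * x + (a + 1) * η - (2 * b - a + 1) * η = 2 * x - 2 * (b - a) * η by ring,
    show 2 * lam + (a + 1) * η + (2 * b - a + 1) * η = 2 * lam + 2 * (b + 1) * η by ring,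
    show 2 * lam + (a + 1) * η - (2 * b - a + 1) * η = 2 * lam - 2 * (b - a) * η by ring,
    show 2 * lam + (a + 1) * η + (a + 1) * η = 2 * lam + 2 * (a + 1) * η by ring,
    show 2 * lam + (a + 1) * η - (a + 1) * η = 2 * lam by ring,
    show 2 * x + (a + 1) * η + (a + 1) * η = 2 * x + 2 * (a + 1) * η by ring,
    show 2 * x + (a + 1) * η - (a + 1) * η = 2 * x by ring] at w₂
  generalize coeffCore τ η ℓ n k x lam = W
  generalize constA τ η ℓ (k + 1) = c₁ at *
  generalize constA τ η ℓ k = c₀ at *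
  generalize theta1 τ (2 * x + 2 * lam + 2 * (a - b) * η) = z₁ at *
  generalize theta1 τ (2 * x + 2 * lam + 2 * (a + 1) * η) = z₂ at *
  generalize theta1 τ (2 * (a + 1) * η) = t₁ at *
  generalize theta1 τ (2 * (b - a) * η) = t₂ at *
  generalize theta1 τ (2 * (b + 1) * η) = t₃ at *
  generalize theta1 τ (2 * x - 2 * lam) = t₄ at *
  clear e₁ e₂ e₃ e₄
  generalize theta1 τ (2 * x - 2 * (b + 1) * η) = p₁ at *
  generalize theta1 τ (2 * x + 2 * (b + 1) * η) = p₂ at *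
  generalize theta1 τ (2 * x + 2 * (a + 1) * η) = p₃ at *
  generalize theta1 τ (2 * x - 2 * (b - a) * η) = p₄ at *
  generalize theta1 τ (2 * lam - 2 * (b + 1) * η) = q₁ at *
  generalize theta1 τ (2 * lam + 2 * (b + 1) * η) = q₂ at *
  generalize theta1 τ (2 * lam + 2 * (a + 1) * η) = q₃ at *
  generalize theta1 τ (2 * lam - 2 * (b - a) * η) = q₄ at *
  field_simp
  linear_combination -W * c₁ * z₂ * w₁ - W * c₀ * z₁ * w₂ + W * z₁ * z₂ * t₄ * t₃ * hc

end Coefficients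

/-! ### The exchange relation between L and A_λ -/

section Operators

variable {τ η : ℂ} {ℓ : ℕ}

/-- At either end of the range of shifts each side has a single term, and no theta identity is
needed: the two splittings of a product with ℓ + 1 factors suffice. -/
lemma coeffA_exchange_zero (τ η : ℂ) (ℓ : ℕ) (x lam : ℂ) :
    theta1 τ (2 * lam) * (theta1 τ (2 * x + 2 * ℓ * η) * coeffA τ η ℓ 0 (x - η) lam)
      = theta1 τ (2 * x) * (theta1 τ (2 * lam + 2 * ℓ * η) * coeffA τ η ℓ 0 x (lam - η)) := by
  have h (u : ℂ) := (plusProd_succ' τ η ℓ ℓ u).symm.trans (plusProd_succ τ η ℓ ℓ u)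
  simp only [sub_self, mul_zero, zero_mul, add_zero] at h
  have e₁ := h (2 * x)
  have e₂ := h (2 * lam)
  rw [coeffA_eq, coeffA_eq, mul_sub 2 x η, mul_sub 2 lam η,
    show 2 * x - 2 * η + 2 * lam = 2 * x + (2 * lam - 2 * η) by ring]
  simp only [minusProd, Finset.range_zero, Finset.prod_empty, tsub_zero, div_eq_mul_inv]
  generalize (∏ j ∈ Finset.range ℓ,
    theta1 τ (2 * x + (2 * lam - 2 * η) + 2 * (((0 : ℕ) : ℂ) - j) * η))⁻¹ = D
  linear_combination theta1 τ (2 * lam) * constA τ η ℓ 0 * D * plusProd τ η ℓ ℓ (2 * lam) * e₁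
    - theta1 τ (2 * x) * constA τ η ℓ 0 * D * plusProd τ η ℓ ℓ (2 * x) * e₂

lemma coeffA_exchange_last (τ η : ℂ) (ℓ : ℕ) (x lam : ℂ) :
    theta1 τ (2 * lam) * (theta1 τ (2 * x - 2 * ℓ * η) * coeffA τ η ℓ ℓ (x + η) lam)
      = theta1 τ (2 * x) * (theta1 τ (2 * lam - 2 * ℓ * η) * coeffA τ η ℓ ℓ x (lam + η)) := by
  have h (u : ℂ) := (minusProd_succ' τ η ℓ ℓ u).symm.trans (minusProd_succ τ η ℓ ℓ u)
  simp only [sub_self, mul_zero, zero_mul, sub_zero] at h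
  have e₁ := h (2 * x)
  have e₂ := h (2 * lam)
  rw [coeffA_eq, coeffA_eq, mul_add 2 x η, mul_add 2 lam η,
    show 2 * x + 2 * η + 2 * lam = 2 * x + (2 * lam + 2 * η) by ring]
  simp only [plusProd, Finset.range_zero, Finset.prod_empty, tsub_self, div_eq_mul_inv]
  generalize (∏ j ∈ Finset.range ℓ,
    theta1 τ (2 * x + (2 * lam + 2 * η) + 2 * ((ℓ : ℂ) + j - ℓ) * η))⁻¹ = D
  linear_combination theta1 τ (2 * lam) * constA τ η ℓ ℓ * D * minusProd τ η ℓ ℓ (2 * lam) * e₁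
    - theta1 τ (2 * x) * constA τ η ℓ ℓ * D * minusProd τ η ℓ ℓ (2 * x) * e₂

/-- Comparison of the coefficients of G(0), ..., G(n+1): the two extreme ones come from one sum
each, the others from both. -/
lemma sum_range_mul_succ_add_eq {R : Type*} [CommRing R] {u v u' v' : ℕ → R} (G : ℕ → R) {n : ℕ}
    (h₀ : v 0 = v' 0) (hn : u n = u' n) (h : ∀ k < n, u k + v (k + 1) = u' k + v' (k + 1)) :
    ∑ k ∈ Finset.range (n + 1), u k * G (k + 1) + ∑ k ∈ Finset.range (n + 1), v k * G k
      = ∑ k ∈ Finset.range (n + 1), u' k * G (k + 1)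
        + ∑ k ∈ Finset.range (n + 1), v' k * G k := by
  have key : ∑ k ∈ Finset.range n, u k * G (k + 1) + ∑ k ∈ Finset.range n, v (k + 1) * G (k + 1)
      = ∑ k ∈ Finset.range n, u' k * G (k + 1)
        + ∑ k ∈ Finset.range n, v' (k + 1) * G (k + 1) := by
    rw [← Finset.sum_add_distrib, ← Finset.sum_add_distrib]
    refine Finset.sum_congr rfl fun k hk => ?_
    rw [← add_mul, ← add_mul, h k (Finset.mem_range.1 hk)]
  rw [Finset.sum_range_succ, Finset.sum_range_succ', Finset.sum_range_succ _ n,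
    Finset.sum_range_succ' _ n, hn, h₀]
  linear_combination key

/-- The exchange relation between the Lamé operator and the operators `A_lam`. -/
lemma lameOp_opA (hτ : 0 < τ.im) (hℓ : 1 ≤ ℓ)
    (hη : ∀ j : ℕ, 1 ≤ j → j ≤ ℓ → ellNum τ η j ≠ 0) (lam : ℂ) (F : ℂ → ℂ) :
    ∀ᶠ x in codiscrete ℂ, theta1 τ (2 * lam) * lameOp τ η ℓ (opA τ η ℓ lam F) x
      = theta1 τ (2 * lam + 2 * ℓ * η) * opA τ η ℓ (lam - η) F x
        + theta1 τ (2 * lam - 2 * ℓ * η) * opA τ η ℓ (lam + η) F x := by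
  have hu : theta1 τ (2 * (1 : ℕ) * η) ≠ 0 := by simpa [ellNum] using hη 1 le_rfl hℓ
  have hz (b : ℂ) := eventually_theta1_ne_zero hτ hu (two_ne_zero' ℂ) b
  have hz₁ : ∀ᶠ x in codiscrete ℂ, ∀ k ∈ Finset.range ℓ,
      theta1 τ (2 * x + (2 * lam + 2 * ((k : ℂ) - ℓ) * η)) ≠ 0 :=
    (eventually_all_finset _).2 fun k _ => hz _
  have hz₂ : ∀ᶠ x in codiscrete ℂ, ∀ k ∈ Finset.range ℓ,
      theta1 τ (2 * x + (2 * lam + 2 * (k + 1) * η)) ≠ 0 :=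
    (eventually_all_finset _).2 fun k _ => hz _
  filter_upwards [hz 0, hz₁, hz₂] with x hx h₁ h₂
  rw [add_zero] at hx
  simp only [← add_assoc] at h₁ h₂
  -- `G 0`, ..., `G (ℓ + 1)` are the values of F at all the points occurring on either side.
  set G : ℕ → ℂ := fun m => F (x + (2 * m * η - ℓ * η - η + lam)) with hG
  have s₁ : opA τ η ℓ lam F (x + η)
      = ∑ k ∈ Finset.range (ℓ + 1), coeffA τ η ℓ k (x + η) lam * G (k + 1) :=
    Finset.sum_congr rfl fun k _ => by simp only [hG]; push_cast; ring_nf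
  have s₂ : opA τ η ℓ lam F (x - η)
      = ∑ k ∈ Finset.range (ℓ + 1), coeffA τ η ℓ k (x - η) lam * G k :=
    Finset.sum_congr rfl fun k _ => by simp only [hG]; ring_nf
  have s₃ : opA τ η ℓ (lam - η) F x
      = ∑ k ∈ Finset.range (ℓ + 1), coeffA τ η ℓ k x (lam - η) * G k :=
    Finset.sum_congr rfl fun k _ => by simp only [hG]; ring_nf
  have s₄ : opA τ η ℓ (lam + η) F x
      = ∑ k ∈ Finset.range (ℓ + 1), coeffA τ η ℓ k x (lam + η) * G (k + 1) :=
    Finset.sum_congr rfl fun k _ => by simp only [hG]; push_cast; ring_nf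
  have key := sum_range_mul_succ_add_eq (n := ℓ) G
    (u := fun k => theta1 τ (2 * lam) * (theta1 τ (2 * x - 2 * ℓ * η) / theta1 τ (2 * x)
        * coeffA τ η ℓ k (x + η) lam))
    (v := fun k => theta1 τ (2 * lam) * (theta1 τ (2 * x + 2 * ℓ * η) / theta1 τ (2 * x)
        * coeffA τ η ℓ k (x - η) lam))
    (u' := fun k => theta1 τ (2 * lam - 2 * ℓ * η) * coeffA τ η ℓ k x (lam + η))
    (v' := fun k => theta1 τ (2 * lam + 2 * ℓ * η) * coeffA τ η ℓ k x (lam - η))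
    (by rw [div_mul_eq_mul_div, ← mul_div_assoc, coeffA_exchange_zero, mul_div_cancel_left₀ _ hx])
    (by rw [div_mul_eq_mul_div, ← mul_div_assoc, coeffA_exchange_last, mul_div_cancel_left₀ _ hx])
    (fun k hk => by
      have := coeffA_exchange hτ hη hk hx (h₁ k (Finset.mem_range.2 hk))
        (h₂ k (Finset.mem_range.2 hk))
      linear_combination this)
  rw [lameOp, s₁, s₂, s₃, s₄]
  simp only [mul_assoc, ← Finset.mul_sum] at key ⊢
  linear_combination key

lemma theta1_two_mul_int (τ η : ℂ) (j : ℤ) : theta1 τ (2 * (j * η)) = ellNum τ η j := by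
  rw [ellNum, mul_assoc]

lemma lameOp_opA_int (hτ : 0 < τ.im) (hℓ : 1 ≤ ℓ)
    (hη : ∀ j : ℕ, 1 ≤ j → j ≤ ℓ → ellNum τ η j ≠ 0) (j : ℤ) (F : ℂ → ℂ) :
    ∀ᶠ x in codiscrete ℂ, ellNum τ η j * lameOp τ η ℓ (opA τ η ℓ (j * η) F) x
      = ellNum τ η (j + ℓ) * opA τ η ℓ ((j - 1 : ℤ) * η) F x
        + ellNum τ η (j - ℓ) * opA τ η ℓ ((j + 1 : ℤ) * η) F x := by
  filter_upwards [lameOp_opA hτ hℓ hη (j * η) F] with x hx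
  rw [theta1_two_mul_int, show (2 * (j * η) + 2 * ℓ * η : ℂ) = 2 * ((j + ℓ : ℤ) * η) by
    push_cast; ring, show (2 * (j * η) - 2 * ℓ * η : ℂ) = 2 * ((j - ℓ : ℤ) * η) by
    push_cast; ring, theta1_two_mul_int, theta1_two_mul_int] at hx
  rw [hx]
  push_cast
  ring_nf

/-- The operator `A_{ℓη}` is the identity. -/
lemma opA_self (hτ : 0 < τ.im) (hℓ : 1 ≤ ℓ)
    (hη : ∀ j : ℕ, 1 ≤ j → j ≤ 2 * ℓ → ellNum τ η j ≠ 0) (F : ℂ → ℂ) :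
    opA τ η ℓ ((ℓ : ℤ) * η) F =ᶠ[codiscrete ℂ] F := by
  have hu : theta1 τ (2 * (1 : ℕ) * η) ≠ 0 := by simpa [ellNum] using hη 1 le_rfl (by lia)
  have hz : ∀ᶠ x in codiscrete ℂ, ∀ j ∈ Finset.range ℓ,
      theta1 τ (2 * x + 2 * ((ℓ : ℂ) - j) * η) ≠ 0 :=
    (eventually_all_finset _).2 fun k _ => eventually_theta1_ne_zero hτ hu (two_ne_zero' ℂ) _
  filter_upwards [hz] with x hx
  -- Every term with k ≥ 1 contains θ₁(2λ - 2ℓη) = θ₁(0) = 0. In the term k = 0 the shift is zero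
  -- and all products cancel, because [2ℓ]! is [ℓ]! times the product in λ.
  rw [opA, Finset.sum_range_succ', Finset.sum_eq_zero, zero_add]
  · have h₁ : ∏ j ∈ Finset.range ℓ, theta1 τ (2 * x + 2 * (ℓ * η) + 2 * (((0 : ℕ) : ℂ) - j) * η)
        = plusProd τ η ℓ ℓ (2 * x) :=
      Finset.prod_congr rfl fun j _ => by push_cast; ring_nf
    have h₂ : ellFactorial τ η (2 * ℓ) = ellFactorial τ η ℓ * plusProd τ η ℓ ℓ (2 * (ℓ * η)) := by
      have h (n : ℕ) : ellFactorial τ η (ℓ + n)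
          = ellFactorial τ η ℓ * ∏ i ∈ Finset.range n, ellNum τ η (ℓ + i + 1) := by
        induction n with
        | zero => simp
        | succ n ih =>
          rw [← add_assoc, ellFactorial_succ, ih, Finset.prod_range_succ, mul_assoc]
          push_cast
          rfl
      rw [two_mul ℓ, h, plusProd, ← Finset.prod_range_reflect]
      congr 1
      refine Finset.prod_congr rfl fun j hj => ?_
      rw [Finset.mem_range] at hj
      rw [ellNum, Nat.cast_sub (by lia), Nat.cast_sub (by lia)]
      push_cast
      ring_nf
    have h₃ : plusProd τ η ℓ ℓ (2 * x) ≠ 0 := Finset.prod_ne_zero_iff.2 hx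
    have h₄ := ellFactorial_ne_zero hη le_rfl
    have h₅ := h₄
    rw [h₂] at h₅
    have h₆ := left_ne_zero_of_mul h₅
    have h₇ := right_ne_zero_of_mul h₅
    rw [coeffA_eq]
    simp only [Int.cast_natCast, tsub_zero]
    rw [h₁, constA, ellBinom, h₂, ellFactorial_zero]
    simp only [minusProd, Finset.range_zero, Finset.prod_empty, tsub_zero, Nat.cast_zero]
    rw [show x + (2 * 0 * η - ℓ * η + ℓ * η) = x by ring]
    field_simp
    rw [← mul_assoc] at h₇
    field_simp
  · intro k _
    have : minusProd τ η ℓ (k + 1) (2 * ((ℓ : ℤ) * η)) = 0 := by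
      rw [minusProd_succ', Int.cast_natCast, show (2 * (ℓ * η) - 2 * ℓ * η : ℂ) = 0 by ring,
        theta1_zero hτ, mul_zero]
    rw [coeffA_eq, this]
    simp

end Operators

/-! ### The polynomials A_{jη}(E): recurrence and degree -/

section Determinant

/-- The three-term recurrence for the leading principal minors of a tridiagonal matrix. -/
lemma det_tridiagonal {R : Type*} [CommRing R] {e : ℕ → ℕ → R}
    (he : ∀ i j, i + 1 < j ∨ j + 1 < i → e i j = 0) (s : ℕ) :
    (Matrix.of fun i j : Fin (s + 2) => e i j).det
      = e (s + 1) (s + 1) * (Matrix.of fun i j : Fin (s + 1) => e i j).det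
        - e s (s + 1) * e (s + 1) s * (Matrix.of fun i j : Fin s => e i j).det := by
  -- This is the minor belonging to the penultimate entry of the last row; only the bottom entry of
  -- its last column can be nonzero.
  have hB : ((Matrix.of fun i j : Fin (s + 2) => e i j).submatrix Fin.castSucc
      (Fin.last s).castSucc.succAbove).det
      = e s (s + 1) * (Matrix.of fun i j : Fin s => e i j).det := by
    rw [Matrix.det_succ_column _ (Fin.last s), Fin.sum_univ_castSucc, Finset.sum_eq_zero, zero_add]
    · have h : (Matrix.of fun i j : Fin (s + 2) => e i j).submatrix Fin.castSucc
          (Fin.last s).castSucc.succAbove (Fin.last s) (Fin.last s) = e s (s + 1) := by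
        simp [Fin.succAbove, Matrix.submatrix_apply]
      have h' : ((Matrix.of fun i j : Fin (s + 2) => e i j).submatrix Fin.castSucc
          (Fin.last s).castSucc.succAbove).submatrix (Fin.last s).succAbove (Fin.last s).succAbove
          = Matrix.of fun i j : Fin s => e i j := by
        ext i j
        simp [Matrix.submatrix_apply, Fin.succAbove, Fin.lt_def]
      rw [h, h', Fin.val_last, ← two_mul, pow_mul]
      simp
    · intro i _
      have h : (Matrix.of fun i j : Fin (s + 2) => e i j).submatrix Fin.castSucc
          (Fin.last s).castSucc.succAbove i.castSucc (Fin.last s) = 0 := by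
        simp only [Matrix.submatrix_apply, Matrix.of_apply]
        exact he _ _ (Or.inl (by simp [Fin.succAbove]))
      rw [h]
      simp
  rw [Matrix.det_succ_row _ (Fin.last (s + 1)), Fin.sum_univ_castSucc, Fin.sum_univ_castSucc,
    Finset.sum_eq_zero, zero_add]
  · rw [Fin.succAbove_last, hB]
    have h' : (Matrix.of fun i j : Fin (s + 2) => e i j).submatrix Fin.castSucc Fin.castSucc
          = Matrix.of fun i j : Fin (s + 1) => e i j := by
      ext i j
      simp [Matrix.submatrix_apply]
    rw [h']
    simp only [Fin.val_last, Matrix.of_apply, Fin.val_castSucc]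
    rw [show s + 1 + s = 2 * s + 1 by ring, ← two_mul, pow_succ, pow_mul, pow_mul]
    simp only [even_two, Even.neg_pow, one_pow]
    ring
  · intro i _
    have h : (Matrix.of fun i j : Fin (s + 2) => e i j) (Fin.last (s + 1)) i.castSucc.castSucc
        = 0 := he _ _ (Or.inr (by simp))
    rw [h]
    simp

variable {τ η : ℂ} {ℓ : ℕ}

lemma det_lameMatrix_zero (τ η : ℂ) (ℓ : ℕ) : (lameMatrix τ η ℓ 0).det = 1 :=
  Matrix.det_isEmpty

lemma det_lameMatrix_one (τ η : ℂ) (ℓ : ℕ) : (lameMatrix τ η ℓ 1).det = X := by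
  simp [lameMatrix]

lemma det_lameMatrix_add_two (τ η : ℂ) (ℓ s : ℕ) :
    (lameMatrix τ η ℓ (s + 2)).det = X * (lameMatrix τ η ℓ (s + 1)).det
      - C (ellNum τ η (-(s + 1)) / ellNum τ η (ℓ - s)
          * (ellNum τ η (2 * ℓ - s) / ellNum τ η (ℓ - s - 1)))
        * (lameMatrix τ η ℓ s).det := by
  have h := det_tridiagonal (e := fun a b : ℕ =>
    let i : ℤ := a + 1
    let j : ℤ := b + 1
    (if i = j then X else 0)
      + (if i = j - 1 then C (ellNum τ η (-i) / ellNum τ η (ℓ + 1 - i)) else 0)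
      + (if i = j + 1 then C (ellNum τ η (2 * ℓ + 2 - i) / ellNum τ η (ℓ + 1 - i)) else 0))
    (fun i j hij => by
      have h₁ : ¬ (i : ℤ) + 1 = j + 1 := by lia
      have h₂ : ¬ (i : ℤ) + 1 = j + 1 - 1 := by lia
      have h₃ : ¬ (i : ℤ) + 1 = j + 1 + 1 := by lia
      simp only [h₁, h₂, h₃, if_false, add_zero]) s
  refine h.trans ?_
  have h₁ : ¬ ((s + 1 : ℕ) : ℤ) + 1 = ((s + 1 : ℕ) : ℤ) + 1 - 1 := by lia
  have h₂ : ¬ ((s + 1 : ℕ) : ℤ) + 1 = ((s + 1 : ℕ) : ℤ) + 1 + 1 := by lia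
  have h₃ : ¬ (s : ℤ) + 1 = ((s + 1 : ℕ) : ℤ) + 1 := by lia
  have h₄ : (s : ℤ) + 1 = ((s + 1 : ℕ) : ℤ) + 1 - 1 := by lia
  have h₅ : ¬ (s : ℤ) + 1 = ((s + 1 : ℕ) : ℤ) + 1 + 1 := by lia
  have h₆ : ¬ ((s + 1 : ℕ) : ℤ) + 1 = (s : ℤ) + 1 := by lia
  have h₇ : ¬ ((s + 1 : ℕ) : ℤ) + 1 = (s : ℤ) + 1 - 1 := by lia
  have h₈ : ((s + 1 : ℕ) : ℤ) + 1 = (s : ℤ) + 1 + 1 := by lia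
  simp only [h₁, h₂, h₃, h₅, h₆, h₇, if_false, if_true, add_zero, zero_add]
  rw [if_pos h₄, if_pos h₈, ← C_mul,
    show (ℓ : ℤ) + 1 - (s + 1) = ℓ - s by ring,
    show (2 * ℓ : ℤ) + 2 - (((s + 1 : ℕ) : ℤ) + 1) = 2 * ℓ - s by push_cast; ring,
    show (ℓ : ℤ) + 1 - (((s + 1 : ℕ) : ℤ) + 1) = ℓ - s - 1 by push_cast; ring]
  rfl

lemma monic_det_lameMatrix (τ η : ℂ) (ℓ s : ℕ) :
    (lameMatrix τ η ℓ s).det.Monic ∧ (lameMatrix τ η ℓ s).det.natDegree = s := by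
  induction s using Nat.twoStepInduction with
  | zero => rw [det_lameMatrix_zero]; exact ⟨monic_one, natDegree_one⟩
  | one => rw [det_lameMatrix_one]; exact ⟨monic_X, natDegree_X⟩
  | more s ih₀ ih₁ =>
    rw [det_lameMatrix_add_two]
    generalize ellNum τ η (-(s + 1)) / ellNum τ η (ℓ - s)
      * (ellNum τ η (2 * ℓ - s) / ellNum τ η (ℓ - s - 1)) = c
    have hm := monic_X.mul ih₁.1
    have hd : (X * (lameMatrix τ η ℓ (s + 1)).det).natDegree = s + 2 := by
      rw [monic_X.natDegree_mul ih₁.1, ih₁.2, natDegree_X]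
      ring
    have hlt : (C c * (lameMatrix τ η ℓ s).det).degree
        < (X * (lameMatrix τ η ℓ (s + 1)).det).degree := by
      rw [degree_eq_natDegree hm.ne_zero, hd]
      rw [← smul_eq_C_mul]
      refine (degree_smul_le _ _).trans_lt ?_
      rw [degree_eq_natDegree ih₀.1.ne_zero, ih₀.2]
      exact_mod_cast (by lia : s < s + 2)
    refine ⟨hm.sub_of_left hlt, ?_⟩
    rw [natDegree, degree_sub_eq_left_of_degree_lt hlt]
    exact hd

/-- The constant factor of `lamePoly`. -/
noncomputable def lameConst (τ η : ℂ) (ℓ : ℕ) (s : ℕ) : ℂ :=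
  ellBinom τ η ℓ s * (ellBinom τ η (2 * ℓ) s)⁻¹

lemma lamePoly_natCast (τ η : ℂ) (ℓ j : ℕ) :
    lamePoly τ η ℓ j = C (lameConst τ η ℓ (ℓ - j)) * (lameMatrix τ η ℓ (ℓ - j)).det := by
  simp [lamePoly, lameConst]

lemma lamePoly_neg (τ η : ℂ) (ℓ : ℕ) (j : ℤ) : lamePoly τ η ℓ (-j) = lamePoly τ η ℓ j := by
  rw [lamePoly, lamePoly, Int.natAbs_neg]

lemma lameConst_ne_zero (hη : ∀ j : ℕ, 1 ≤ j → j ≤ 2 * ℓ → ellNum τ η j ≠ 0) {s : ℕ}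
    (hs : s ≤ ℓ) : lameConst τ η ℓ s ≠ 0 := by
  have h {n : ℕ} (hn : n ≤ 2 * ℓ) := ellFactorial_ne_zero hη hn
  rw [lameConst, ellBinom, ellBinom]
  exact mul_ne_zero (div_ne_zero (h (by lia)) (mul_ne_zero (h (by lia)) (h (by lia))))
    (inv_ne_zero (div_ne_zero (h (by lia)) (mul_ne_zero (h (by lia)) (h (by lia)))))

lemma degree_lamePoly (hη : ∀ j : ℕ, 1 ≤ j → j ≤ 2 * ℓ → ellNum τ η j ≠ 0) (j : ℤ) :
    (lamePoly τ η ℓ j).degree = ((ℓ - j.natAbs : ℕ) : WithBot ℕ) := by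
  have h := monic_det_lameMatrix τ η ℓ (ℓ - j.natAbs)
  have hc := lameConst_ne_zero hη (s := ℓ - j.natAbs) (by lia)
  rw [lamePoly]
  rw [lameConst] at hc
  rw [degree_C_mul hc, degree_eq_natDegree h.1.ne_zero, h.2]

lemma lameConst_zero (hη : ∀ j : ℕ, 1 ≤ j → j ≤ 2 * ℓ → ellNum τ η j ≠ 0) :
    lameConst τ η ℓ 0 = 1 := by
  have h₁ := ellFactorial_ne_zero hη (n := ℓ) (by lia)
  have h₂ := ellFactorial_ne_zero hη (n := 2 * ℓ) le_rfl
  rw [lameConst, ellBinom, ellBinom, ellFactorial_zero]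
  simp [h₁, h₂]

lemma lamePoly_self (hη : ∀ j : ℕ, 1 ≤ j → j ≤ 2 * ℓ → ellNum τ η j ≠ 0) :
    lamePoly τ η ℓ ℓ = 1 := by
  rw [lamePoly_natCast, Nat.sub_self, det_lameMatrix_zero, lameConst_zero hη]
  simp

/-- Rescaling by these constants turns the recurrence of the monic minors into one with the
coefficients of the exchange relation. -/
lemma lameConst_succ (hη : ∀ j : ℕ, 1 ≤ j → j ≤ 2 * ℓ → ellNum τ η j ≠ 0) {s : ℕ} (hs : s < ℓ) :
    lameConst τ η ℓ (s + 1) * ellNum τ η (2 * ℓ - s) = lameConst τ η ℓ s * ellNum τ η (ℓ - s) := by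
  obtain ⟨m, rfl⟩ : ∃ m, ℓ = s + 1 + m := ⟨ℓ - s - 1, by lia⟩
  have h {n : ℕ} (hn : n ≤ 2 * (s + 1 + m)) := ellFactorial_ne_zero hη hn
  have h₁ := ellFactorial_succ τ η s
  have h₂ := ellFactorial_succ τ η m
  have h₃ := ellFactorial_succ τ η (s + 2 * m + 1)
  have g₁ := h (n := s + 1) (by lia)
  have g₂ := h (n := m + 1) (by lia)
  have g₃ := h (n := s + 2 * m + 1 + 1) (by lia)
  have g₄ := h (n := s + 1 + m) (by lia)
  have g₅ := h (n := 2 * (s + 1 + m)) le_rfl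
  rw [lameConst, lameConst, ellBinom, ellBinom, ellBinom, ellBinom,
    show s + 1 + m - (s + 1) = m by lia, show s + 1 + m - s = m + 1 by lia,
    show 2 * (s + 1 + m) - (s + 1) = s + 2 * m + 1 by lia,
    show 2 * (s + 1 + m) - s = s + 2 * m + 1 + 1 by lia,
    show (2 * ((s + 1 + m : ℕ) : ℤ) - s) = (s + 2 * m + 1 : ℕ) + 1 by push_cast; ring,
    show (((s + 1 + m : ℕ) : ℤ) - s) = m + 1 by push_cast; ring]
  rw [h₁] at g₁ ⊢
  rw [h₂] at g₂ ⊢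
  rw [h₃] at g₃ ⊢
  have := left_ne_zero_of_mul g₁
  have := right_ne_zero_of_mul g₁
  have := left_ne_zero_of_mul g₂
  have := right_ne_zero_of_mul g₂
  have := left_ne_zero_of_mul g₃
  have := right_ne_zero_of_mul g₃
  field_simp

lemma lamePoly_recurrence_nat (hτ : 0 < τ.im)
    (hη : ∀ j : ℕ, 1 ≤ j → j ≤ 2 * ℓ → ellNum τ η j ≠ 0) {j : ℕ} (hj : j < ℓ) :
    C (ellNum τ η (j + 1)) * X * lamePoly τ η ℓ (j + 1)
      = C (ellNum τ η (j + 1 + ℓ)) * lamePoly τ η ℓ j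
        + C (ellNum τ η (j + 1 - ℓ)) * lamePoly τ η ℓ (j + 2) := by
  rw [show (j : ℤ) + 1 = (j + 1 : ℕ) by push_cast; ring,
    show (j : ℤ) + 2 = (j + 2 : ℕ) by push_cast; ring, lamePoly_natCast, lamePoly_natCast,
    lamePoly_natCast]
  obtain ⟨s, hs⟩ : ∃ s, ℓ = j + 1 + s := ⟨ℓ - j - 1, by lia⟩
  have hc := lameConst_succ hη (s := s) (by lia)
  rw [show (ℓ - s : ℤ) = (j + 1 : ℕ) by lia, show (2 * ℓ - s : ℤ) = (j + 1 : ℕ) + ℓ by lia] at hc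
  rw [show ℓ - j = s + 1 by lia, show ℓ - (j + 1) = s by lia]
  -- For s = 0 the index j + 2 = ℓ + 1 is out of range and `lamePoly` has no meaning there, but its
  -- coefficient is [0] = 0.
  rcases s with _ | s
  · rw [show ((j + 1 : ℕ) - ℓ : ℤ) = 0 by lia, ellNum_zero hτ, zero_add, det_lameMatrix_one,
      det_lameMatrix_zero, C_0, zero_mul, add_zero, mul_one]
    have hc' := congrArg C hc
    simp only [C_mul, zero_add] at hc'
    linear_combination -X * hc'
  · have hc₀ := lameConst_succ hη (s := s) (by lia)
    rw [show ℓ - (j + 2) = s by lia, det_lameMatrix_add_two]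
    rw [show (ℓ - s : ℤ) = (j + 2 : ℕ) by lia, show (2 * ℓ - s : ℤ) = (j + 2 : ℕ) + ℓ by lia]
      at hc₀ ⊢
    rw [show ((j + 2 : ℕ) - 1 : ℤ) = (j + 1 : ℕ) by lia,
      show (-(s + 1) : ℤ) = (j + 1 : ℕ) - ℓ by lia]
    have g₁ := hη (j + 1) (by lia) (by lia)
    have g₂ := hη (j + 2) (by lia) (by lia)
    have hX := congrArg C hc
    have h₀ : ellNum τ η ((j + 1 : ℕ) + ℓ) * lameConst τ η ℓ (s + 1 + 1)
        * (ellNum τ η ((j + 1 : ℕ) - ℓ) / ellNum τ η (j + 2 : ℕ)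
          * (ellNum τ η ((j + 2 : ℕ) + ℓ) / ellNum τ η (j + 1 : ℕ)))
        = ellNum τ η ((j + 1 : ℕ) - ℓ) * lameConst τ η ℓ s := by
      field_simp
      linear_combination ellNum τ η ((j + 1 : ℕ) - ℓ) * (ellNum τ η ((j + 2 : ℕ) + ℓ) * hc
        + ellNum τ η (j + 1 : ℕ) * hc₀)
    have hC := congrArg C h₀
    simp only [C_mul] at hX hC ⊢
    linear_combination -X * (lameMatrix τ η ℓ (s + 1)).det * hX + (lameMatrix τ η ℓ s).det * hC

/-- Negative j reduce to positive ones, since [n] is odd in n and the polynomials are even in j. For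
j = 0 the two terms on the right cancel. -/
lemma lamePoly_recurrence (hτ : 0 < τ.im)
    (hη : ∀ j : ℕ, 1 ≤ j → j ≤ 2 * ℓ → ellNum τ η j ≠ 0) {j : ℤ} (hj : |j| ≤ ℓ) :
    C (ellNum τ η j) * X * lamePoly τ η ℓ j
      = C (ellNum τ η (j + ℓ)) * lamePoly τ η ℓ (j - 1)
        + C (ellNum τ η (j - ℓ)) * lamePoly τ η ℓ (j + 1) := by
  rw [abs_le] at hj
  rcases lt_trichotomy j 0 with h | rfl | h
  · obtain ⟨m, rfl⟩ : ∃ m : ℕ, j = -(m + 1) := ⟨(-j - 1).toNat, by lia⟩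
    have := lamePoly_recurrence_nat hτ hη (j := m) (by lia)
    rw [lamePoly_neg, show (-(m + 1) - 1 : ℤ) = -(m + 2) by ring,
      show (-(m + 1) + 1 : ℤ) = -m by ring, lamePoly_neg, lamePoly_neg,
      show (-(m + 1) + ℓ : ℤ) = -(m + 1 - ℓ) by ring,
      show (-(m + 1) - ℓ : ℤ) = -(m + 1 + ℓ) by ring, ellNum_neg hτ, ellNum_neg hτ, ellNum_neg hτ]
    simp only [C_neg]
    linear_combination -this
  · rw [zero_add, zero_sub, zero_sub, zero_add, ellNum_zero hτ, ellNum_neg hτ, lamePoly_neg]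
    simp
  · obtain ⟨m, rfl⟩ : ∃ m : ℕ, j = m + 1 := ⟨(j - 1).toNat, by lia⟩
    have := lamePoly_recurrence_nat hτ hη (j := m) (by lia)
    rw [add_sub_cancel_right, show (m + 1 + 1 : ℤ) = m + 2 by ring]
    exact this

end Determinant

/-! ### Identities off closed discrete sets -/

section Codiscrete

lemma eventually_codiscrete_iff {p : ℂ → Prop} :
    (∀ᶠ x in codiscrete ℂ, p x) ↔ ∀ z, ∀ᶠ x in 𝓝[≠] z, p x := by
  rw [Filter.Eventually, mem_codiscrete]
  simp only [disjoint_principal_right, compl_compl]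
  rfl

lemma tendsto_mul_add_codiscrete {a : ℂ} (ha : a ≠ 0) (b : ℂ) :
    Tendsto (fun x : ℂ => a * x + b) (codiscrete ℂ) (codiscrete ℂ) := by
  intro s hs
  have hs' : ∀ᶠ x in codiscrete ℂ, x ∈ s := hs
  rw [eventually_codiscrete_iff] at hs'
  refine eventually_codiscrete_iff.2 fun z => ?_
  have ht : Tendsto (fun x : ℂ => a * x + b) (𝓝[≠] z) (𝓝[≠] (a * z + b)) := by
    refine tendsto_nhdsWithin_of_tendsto_nhds_of_eventually_within _
      (Continuous.tendsto' (by fun_prop) _ _ rfl |>.mono_left nhdsWithin_le_nhds) ?_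
    filter_upwards [self_mem_nhdsWithin] with x hx h
    exact hx (mul_left_cancel₀ ha (add_right_cancel h))
  exact ht.eventually (hs' _)

lemma tendsto_add_codiscrete (c : ℂ) :
    Tendsto (fun x : ℂ => x + c) (codiscrete ℂ) (codiscrete ℂ) := by
  simpa using tendsto_mul_add_codiscrete one_ne_zero c

lemma eq_zero_of_eventually_codiscrete {f : ℂ → ℂ} (hf : Continuous f)
    (h : ∀ᶠ x in codiscrete ℂ, f x = 0) (z : ℂ) : f z = 0 := by
  have h₁ : Tendsto f (𝓝[≠] z) (𝓝 (f z)) := hf.continuousAt.tendsto.mono_left nhdsWithin_le_nhds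
  have h₂ : f =ᶠ[𝓝[≠] z] fun _ => 0 := eventually_codiscrete_iff.1 h z
  exact tendsto_nhds_unique (h₁.congr' h₂) tendsto_const_nhds

end Codiscrete

/-! ### A_{jη} as a polynomial in L -/

section Spectrum

variable {τ η : ℂ} {ℓ : ℕ}

/-- The difference Lamé operator as a linear endomorphism. -/
noncomputable def lameEnd (τ η : ℂ) (ℓ : ℕ) : Module.End ℂ (ℂ → ℂ) where
  toFun := lameOp τ η ℓ
  map_add' F G := by
    ext x
    simp only [lameOp, Pi.add_apply]
    ring
  map_smul' c F := by
    ext x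
    simp only [lameOp, Pi.smul_apply, smul_eq_mul, RingHom.id_apply]
    ring

/-- The operator identities hold only off closed discrete sets; they can be composed because L
respects this equality, translations preserving such sets. -/
lemma lameEnd_congr {F G : ℂ → ℂ} (h : F =ᶠ[codiscrete ℂ] G) :
    lameEnd τ η ℓ F =ᶠ[codiscrete ℂ] lameEnd τ η ℓ G := by
  filter_upwards [(tendsto_add_codiscrete η).eventually h,
    (tendsto_add_codiscrete (-η)).eventually h] with x h₁ h₂
  simp only [← sub_eq_add_neg] at h₂
  simp only [lameEnd, LinearMap.coe_mk, AddHom.coe_mk, lameOp, h₁, h₂]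

lemma aeval_lameEnd_congr (p : ℂ[X]) {F G : ℂ → ℂ} (h : F =ᶠ[codiscrete ℂ] G) :
    aeval (lameEnd τ η ℓ) p F =ᶠ[codiscrete ℂ] aeval (lameEnd τ η ℓ) p G := by
  induction p using Polynomial.induction_on generalizing F G with
  | C a =>
    simp only [aeval_C, Module.algebraMap_end_apply]
    exact h.const_smul a
  | add p q hp hq =>
    simp only [map_add, LinearMap.add_apply]
    exact (hp h).add (hq h)
  | monomial n a ih =>
    simp only [pow_succ, ← mul_assoc, map_mul, aeval_X, Module.End.mul_apply] at ih ⊢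
    exact ih (lameEnd_congr h)

/-- Both sides satisfy the same recursion in j and agree at j = ℓ. The descent through n = ℓ - j
reaches j = -ℓ because the divisor [j+ℓ] is nonzero for -ℓ < j ≤ ℓ. -/
lemma opA_eventuallyEq_aeval (hτ : 0 < τ.im) (hℓ : 1 ≤ ℓ)
    (hη : ∀ j : ℕ, 1 ≤ j → j ≤ 2 * ℓ → ellNum τ η j ≠ 0) (j : ℤ) (hj : |j| ≤ ℓ) (F : ℂ → ℂ) :
    opA τ η ℓ (j * η) F =ᶠ[codiscrete ℂ] aeval (lameEnd τ η ℓ) (lamePoly τ η ℓ j) F := by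
  suffices H : ∀ n : ℕ, n ≤ 2 * ℓ → opA τ η ℓ (((ℓ - n : ℤ) : ℂ) * η) F
      =ᶠ[codiscrete ℂ] aeval (lameEnd τ η ℓ) (lamePoly τ η ℓ (ℓ - n)) F by
    rw [abs_le] at hj
    have := H (ℓ - j).toNat (by lia)
    rwa [show (ℓ - ((ℓ - j).toNat : ℤ) : ℤ) = j by lia] at this
  intro n
  induction n using Nat.strong_induction_on with
  | _ n ih =>
  intro hn
  rcases n with _ | n
  · rw [Nat.cast_zero, sub_zero, lamePoly_self hη]
    simpa using opA_self hτ hℓ hη F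
  have h₀ := lameEnd_congr (τ := τ) (η := η) (ℓ := ℓ) (ih n (by lia) (by lia))
  have h₁ := lameOp_opA_int hτ hℓ (fun j h₁ h₂ => hη j h₁ (by lia)) (ℓ - n) F
  -- The coefficient is kept: for n = 0 nothing is known at index ℓ + 1, but there the coefficient
  -- is [0] = 0.
  have h₂ : ∀ᶠ x in codiscrete ℂ, ellNum τ η (ℓ - n - ℓ)
        * opA τ η ℓ ((ℓ - n + 1 : ℤ) * η) F x
      = ellNum τ η (ℓ - n - ℓ)
        * aeval (lameEnd τ η ℓ) (lamePoly τ η ℓ (ℓ - n + 1)) F x := by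
    rcases n with _ | n
    · simp [ellNum_zero hτ]
    · have := ih n (by lia) (by lia)
      rw [show (ℓ - n : ℤ) = ℓ - (n + 1 : ℕ) + 1 by lia] at this
      filter_upwards [this] with x hx
      rw [hx]
  have hrec := lamePoly_recurrence hτ hη (j := ℓ - n) (abs_le.2 ⟨by lia, by lia⟩)
  have hrec' := congrArg (fun p => aeval (lameEnd τ η ℓ) p F) hrec
  simp only [mul_comm _ X, mul_assoc X, map_add, map_mul, aeval_C, aeval_X, LinearMap.add_apply,
    Module.End.mul_apply, Module.algebraMap_end_apply, map_smul] at hrec'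
  have hne : ellNum τ η (ℓ - n + ℓ) ≠ 0 := by
    have := hη (2 * ℓ - n) (by lia) (by lia)
    rwa [show ((2 * ℓ - n : ℕ) : ℤ) = ℓ - n + ℓ by lia] at this
  filter_upwards [h₀, h₁, h₂] with x h₀ h₁ h₂
  have hx := congrFun hrec' x
  simp only [Pi.add_apply, Pi.smul_apply, smul_eq_mul] at hx
  rw [show (ℓ - (n + 1 : ℕ) : ℤ) = ℓ - n - 1 by lia]
  refine mul_left_cancel₀ hne ?_
  have h₀' : lameOp τ η ℓ (opA τ η ℓ ((ℓ - n : ℤ) * η) F) x = _ := h₀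
  rw [h₀', h₂] at h₁
  linear_combination hx - h₁

lemma opA_commute (hτ : 0 < τ.im) (hℓ : 1 ≤ ℓ)
    (hη : ∀ j : ℕ, 1 ≤ j → j ≤ 2 * ℓ → ellNum τ η j ≠ 0) {i j : ℤ} (hi : |i| ≤ ℓ) (hj : |j| ≤ ℓ)
    (F : ℂ → ℂ) : opA τ η ℓ (i * η) (opA τ η ℓ (j * η) F)
      =ᶠ[codiscrete ℂ] opA τ η ℓ (j * η) (opA τ η ℓ (i * η) F) := by
  have h {i j : ℤ} (hi : |i| ≤ ℓ) (hj : |j| ≤ ℓ) : opA τ η ℓ (i * η) (opA τ η ℓ (j * η) F)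
      =ᶠ[codiscrete ℂ]
        aeval (lameEnd τ η ℓ) (lamePoly τ η ℓ i * lamePoly τ η ℓ j) F := by
    rw [map_mul, Module.End.mul_apply]
    exact (opA_eventuallyEq_aeval hτ hℓ hη i hi _).trans
      (aeval_lameEnd_congr _ (opA_eventuallyEq_aeval hτ hℓ hη j hj F))
  refine (h hi hj).trans ?_
  rw [mul_comm]
  exact (h hj hi).symm

/-- As X - E divides p - p(E), one has p(L)Ψ - p(E)Ψ = q(L)(L - E)Ψ for some polynomial q, and q(L)
preserves vanishing off a closed discrete set. -/
lemma opA_eigenvalue (hτ : 0 < τ.im) (hℓ : 1 ≤ ℓ)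
    (hη : ∀ j : ℕ, 1 ≤ j → j ≤ 2 * ℓ → ellNum τ η j ≠ 0) {j : ℤ} (hj : |j| ≤ ℓ) {E : ℂ}
    {Ψ : ℂ → ℂ} (hΨ : lameOp τ η ℓ Ψ =ᶠ[codiscrete ℂ] fun x => E * Ψ x) :
    opA τ η ℓ (j * η) Ψ =ᶠ[codiscrete ℂ] fun x => (lamePoly τ η ℓ j).eval E * Ψ x := by
  refine (opA_eventuallyEq_aeval hτ hℓ hη j hj Ψ).trans ?_
  obtain ⟨q, hq⟩ : X - C E ∣ lamePoly τ η ℓ j - C ((lamePoly τ η ℓ j).eval E) := by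
    simp [dvd_iff_isRoot]
  have h₀ : (lameEnd τ η ℓ Ψ - E • Ψ) =ᶠ[codiscrete ℂ] 0 := by
    filter_upwards [hΨ] with x hx
    have hx' : lameEnd τ η ℓ Ψ x = _ := hx
    simp [hx']
  have h₁ := aeval_lameEnd_congr (τ := τ) (η := η) (ℓ := ℓ) q h₀
  rw [map_zero] at h₁
  have h₂ := congrArg (fun p => aeval (lameEnd τ η ℓ) p Ψ) hq
  rw [mul_comm] at h₂
  simp only [map_mul, map_sub, aeval_C, aeval_X, LinearMap.sub_apply, Module.End.mul_apply,
    Module.algebraMap_end_apply] at h₂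
  rw [map_sub, ← h₂] at h₁
  filter_upwards [h₁] with x hx
  simpa [sub_eq_zero] using hx

end Spectrum

/-! ### Linear independence and partial fractions for Φ -/

section PartialFractions

variable {τ η ζ : ℂ} {ℓ : ℕ}

lemma ellNum_natCast (τ η : ℂ) (n : ℕ) : ellNum τ η n = theta1 τ (2 * n * η) := by
  rw [ellNum, Int.cast_natCast]

lemma sum_Icc_one_eq_sum_range {R : Type*} [AddCommMonoid R] (f : ℕ → R) (n : ℕ) :
    ∑ j ∈ Finset.Icc 1 n, f j = ∑ m ∈ Finset.range n, f (m + 1) := by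
  induction n with
  | zero => simp
  | succ n ih => rw [Finset.sum_Icc_succ_top (by lia), ih, Finset.sum_range_succ]

/-- The functions `x ↦ Φ(2x - 2iη, ζ)` are linearly independent. -/
lemma eq_zero_of_sum_Phi (hτ : 0 < τ.im) (hζ : theta1 τ ζ ≠ 0)
    (hη : ∀ j : ℕ, 1 ≤ j → j ≤ ℓ → ellNum τ η j ≠ 0) {r : ℕ → ℂ}
    (h : ∀ᶠ x in codiscrete ℂ,
      ∑ i ∈ Finset.range (ℓ + 1), r i * Phi τ (2 * x - 2 * i * η) ζ = 0)
    {i : ℕ} (hi : i ≤ ℓ) : r i = 0 := by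
  have hθ := (differentiable_theta1 hτ).continuous
  -- Multiplication by all denominators gives a continuous function, which therefore vanishes
  -- everywhere. At x = iη every summand but the i-th contains θ₁(0), which isolates `r i`.
  set g : ℂ → ℂ := fun x => ∑ i ∈ Finset.range (ℓ + 1), r i * (theta1 τ (ζ + (2 * x - 2 * i * η))
    * ∏ j ∈ (Finset.range (ℓ + 1)).erase i, theta1 τ (2 * x - 2 * j * η)) with hg
  have hgc : Continuous g := by
    refine continuous_finsetSum _ fun i _ => ?_
    refine continuous_const.mul ((hθ.comp (by fun_prop)).mul ?_)
    exact continuous_finsetProd _ fun j _ => hθ.comp (by fun_prop)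
  have hz : ∀ᶠ x in codiscrete ℂ, ∀ j ∈ Finset.range (ℓ + 1),
      theta1 τ (2 * x - 2 * j * η) ≠ 0 :=
    (eventually_all_finset _).2 fun j _ => by
      simpa [sub_eq_add_neg] using eventually_theta1_ne_zero hτ hζ (two_ne_zero' ℂ) (-(2 * j * η))
  have hg₀ : ∀ᶠ x in codiscrete ℂ, g x = 0 := by
    filter_upwards [h, hz] with x hx hne
    have : g x = theta1 τ ζ * (∏ j ∈ Finset.range (ℓ + 1), theta1 τ (2 * x - 2 * j * η))
        * ∑ i ∈ Finset.range (ℓ + 1), r i * Phi τ (2 * x - 2 * i * η) ζ := by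
      rw [hg, Finset.mul_sum]
      refine Finset.sum_congr rfl fun i hi => ?_
      rw [← Finset.mul_prod_erase _ _ hi, Phi]
      have hi₀ := hne i hi
      generalize theta1 τ (2 * x - 2 * i * η) = p at hi₀ ⊢
      field_simp
    rw [this, hx, mul_zero]
  have key := eq_zero_of_eventually_codiscrete hgc hg₀ (i * η)
  have hi' : i ∈ Finset.range (ℓ + 1) := Finset.mem_range.2 (by lia)
  simp only [hg] at key
  rw [Finset.sum_eq_single_of_mem i hi'] at key
  · rw [show ζ + (2 * (i * η) - 2 * i * η) = ζ by ring] at key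
    refine (mul_eq_zero.1 key).resolve_right (mul_ne_zero hζ (Finset.prod_ne_zero_iff.2 ?_))
    intro j hj
    rw [Finset.mem_erase, Finset.mem_range] at hj
    have e : theta1 τ (2 * (i * η) - 2 * j * η) = ellNum τ η (i - j) := by
      rw [ellNum]; push_cast; ring_nf
    rw [e]
    rcases lt_or_gt_of_ne hj.1 with hlt | hlt
    · have := hη (i - j) (by lia) (by lia)
      rwa [Nat.cast_sub hlt.le] at this
    · have := hη (j - i) (by lia) (by lia)
      rw [Nat.cast_sub hlt.le] at this
      rw [show (i - j : ℤ) = -(j - i) by ring, ellNum_neg hτ]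
      exact neg_ne_zero.2 this
  · intro j _ hji
    rw [Finset.prod_eq_zero (Finset.mem_erase.2 ⟨hji.symm, hi'⟩), mul_zero, mul_zero]
    rw [show 2 * (i * η) - 2 * i * η = 0 by ring, theta1_zero hτ]

/-- The expansion of the product of the potential with `Φ` into functions with simple poles. -/
lemma potential_mul_Phi (hτ : 0 < τ.im) (hζ : theta1 τ ζ ≠ 0) {j : ℕ}
    (h₁ : ellNum τ η 1 ≠ 0) (hj : ellNum τ η j ≠ 0) (hj' : ellNum τ η (j + 1) ≠ 0) {y : ℂ}
    (hy : theta1 τ y ≠ 0) (hy₁ : theta1 τ (y - 2 * η) ≠ 0)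
    (hyj : theta1 τ (y - 2 * (j + 1) * η) ≠ 0) :
    theta1 τ (y + 2 * ℓ * η) * theta1 τ (y - 2 * (ℓ + 1) * η)
        / (theta1 τ y * theta1 τ (y - 2 * η)) * Phi τ (y - 2 * (j + 1) * η) ζ
      = ellNum τ η (j + 1 + ℓ) * ellNum τ η (j - ℓ) / (ellNum τ η (j + 1) * ellNum τ η j)
          * Phi τ (y - 2 * (j + 1) * η) ζ
        + ellNum τ η ℓ * ellNum τ η (ℓ + 1) / ellNum τ η 1
          * (theta1 τ (ζ - 2 * j * η) / (ellNum τ η j * theta1 τ ζ) * Phi τ (y - 2 * η) ζ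
            - theta1 τ (ζ - 2 * (j + 1) * η) / (ellNum τ η (j + 1) * theta1 τ ζ)
              * Phi τ y ζ) := by
  -- `w₁` subtracts from the potential its value at y = 2(j+1)η; the remainder contains θ₁(y -
  -- 2(j+1)η), which cancels the pole of Φ there. `w₂` splits what is left between the poles y = 0
  -- and y = 2η.
  have w₁ := theta1_three_term hτ (y - η) ((2 * ℓ + 1) * η) η ((2 * j + 1) * η)
  have w₂ := theta1_three_term hτ (y + ζ / 2 - η) ((2 * j + 1) * η - ζ / 2) (ζ / 2 + η) (ζ / 2 - η)
  have e₁ : ellNum τ η 1 = theta1 τ (2 * η) := by simp [ellNum]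
  have e₂ : ellNum τ η j = theta1 τ (2 * j * η) := by simp [ellNum]
  have e₃ : ellNum τ η (j + 1) = theta1 τ (2 * (j + 1) * η) := by simp [ellNum]
  have e₄ : ellNum τ η ℓ = theta1 τ (2 * ℓ * η) := by simp [ellNum]
  have e₅ : ellNum τ η (ℓ + 1) = theta1 τ (2 * (ℓ + 1) * η) := by simp [ellNum]
  have e₆ : ellNum τ η (j + 1 + ℓ) = theta1 τ (2 * (j + 1 + ℓ) * η) := by simp [ellNum]
  have e₇ : ellNum τ η (j - ℓ) = -theta1 τ (2 * (ℓ - j) * η) := by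
    rw [ellNum, ← theta1_neg hτ]; push_cast; ring_nf
  rw [show y - η + (2 * ℓ + 1) * η = y + 2 * ℓ * η by ring,
    show y - η - (2 * ℓ + 1) * η = y - 2 * (ℓ + 1) * η by ring,
    show η + (2 * j + 1) * η = 2 * (j + 1) * η by ring,
    show η - (2 * j + 1) * η = -(2 * j * η) by ring,
    show y - η + η = y by ring, show y - η - η = y - 2 * η by ring,
    show (2 * ℓ + 1) * η + (2 * j + 1) * η = 2 * (j + 1 + ℓ) * η by ring,
    show (2 * ℓ + 1) * η - (2 * j + 1) * η = 2 * (ℓ - j) * η by ring,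
    show y - η + (2 * j + 1) * η = y + 2 * j * η by ring,
    show y - η - (2 * j + 1) * η = y - 2 * (j + 1) * η by ring,
    show (2 * ℓ + 1) * η + η = 2 * (ℓ + 1) * η by ring,
    show (2 * ℓ + 1) * η - η = 2 * ℓ * η by ring, theta1_neg hτ] at w₁
  rw [show y + ζ / 2 - η + ((2 * j + 1) * η - ζ / 2) = y + 2 * j * η by ring,
    show y + ζ / 2 - η - ((2 * j + 1) * η - ζ / 2) = ζ + (y - 2 * (j + 1) * η) by ring,
    show ζ / 2 + η + (ζ / 2 - η) = ζ by ring, show ζ / 2 + η - (ζ / 2 - η) = 2 * η by ring,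
    show y + ζ / 2 - η + (ζ / 2 + η) = ζ + y by ring,
    show y + ζ / 2 - η - (ζ / 2 + η) = y - 2 * η by ring,
    show (2 * j + 1) * η - ζ / 2 + (ζ / 2 - η) = 2 * j * η by ring,
    show (2 * j + 1) * η - ζ / 2 - (ζ / 2 - η) = -(ζ - 2 * (j + 1) * η) by ring,
    show y + ζ / 2 - η + (ζ / 2 - η) = ζ + (y - 2 * η) by ring,
    show y + ζ / 2 - η - (ζ / 2 - η) = y by ring,
    show (2 * j + 1) * η - ζ / 2 + (ζ / 2 + η) = 2 * (j + 1) * η by ring,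
    show (2 * j + 1) * η - ζ / 2 - (ζ / 2 + η) = -(ζ - 2 * j * η) by ring,
    theta1_neg hτ, theta1_neg hτ] at w₂
  rw [e₁] at h₁
  rw [e₂] at hj
  rw [e₃] at hj'
  rw [e₁, e₂, e₃, e₄, e₅, e₆, e₇, Phi, Phi, Phi]
  generalize theta1 τ (2 * η) = n₁ at *
  generalize theta1 τ (2 * j * η) = n₂ at *
  generalize theta1 τ (2 * (j + 1) * η) = n₃ at *
  generalize theta1 τ (2 * ℓ * η) = n₄ at *
  generalize theta1 τ (2 * (ℓ + 1) * η) = n₅ at *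
  generalize theta1 τ (2 * (j + 1 + ℓ) * η) = n₆ at *
  generalize theta1 τ (2 * (ℓ - j) * η) = n₇ at *
  generalize theta1 τ (y + 2 * ℓ * η) = p₁ at *
  generalize theta1 τ (y - 2 * (ℓ + 1) * η) = p₂ at *
  generalize theta1 τ (y - 2 * η) = p₃ at *
  generalize theta1 τ (y - 2 * (j + 1) * η) = p₄ at *
  generalize theta1 τ (y + 2 * j * η) = p₅ at *
  generalize theta1 τ (ζ + (y - 2 * (j + 1) * η)) = p₆ at *
  generalize theta1 τ (ζ + (y - 2 * η)) = p₇ at *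
  generalize theta1 τ (ζ - 2 * (j + 1) * η) = q₁ at *
  generalize theta1 τ (ζ - 2 * j * η) = q₂ at *
  generalize theta1 τ (ζ + y) = q₃ at *
  generalize theta1 τ ζ = q₀ at *
  generalize theta1 τ y = p₀ at *
  clear e₁ e₂ e₃ e₄ e₅ e₆ e₇
  field_simp
  linear_combination -n₁ * q₀ * p₆ * w₁ + n₄ * n₅ * p₄ * w₂

end PartialFractions

/-! ### The Lamé equation as a linear system -/

section Ansatz

variable {τ η ζ κ K E : ℂ} {ℓ : ℕ}

lemma Phi_add_one (τ x ζ : ℂ) : Phi τ (x + 1) ζ = Phi τ x ζ := by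
  rw [Phi, Phi, ← add_assoc, theta1_add_one, theta1_add_one, neg_mul, neg_div_neg_eq]

lemma Phi_add_tau (τ x ζ : ℂ) :
    Phi τ (x + τ) ζ = cexp (-2 * Real.pi * I * ζ) * Phi τ x ζ := by
  have h : cexp (-Real.pi * I * τ - 2 * Real.pi * I * (ζ + x))
      = cexp (-2 * Real.pi * I * ζ) * cexp (-Real.pi * I * τ - 2 * Real.pi * I * x) := by
    rw [← Complex.exp_add]
    ring_nf
  have h₀ := Complex.exp_ne_zero (-Real.pi * I * τ - 2 * Real.pi * I * x)
  rw [Phi, Phi, ← add_assoc, theta1_add_tau, theta1_add_tau, h]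
  generalize cexp (-Real.pi * I * τ - 2 * Real.pi * I * x) = e at h₀
  field_simp

lemma blochAnsatz_add_half (τ η ζ κ : ℂ) (ℓ : ℕ) (s : ℕ → ℂ) (x : ℂ) :
    blochAnsatz τ η ζ κ ℓ s (x + 1 / 2)
      = cexp (κ * (1 / (2 * η))) * blochAnsatz τ η ζ κ ℓ s x := by
  rw [blochAnsatz, blochAnsatz, ← mul_assoc, ← Complex.exp_add]
  congr 1
  · congr 1
    ring
  · refine Finset.sum_congr rfl fun j _ => ?_
    rw [← Phi_add_one τ (2 * x - 2 * j * η)]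
    ring_nf

lemma blochAnsatz_add_half_tau (τ η ζ κ : ℂ) (ℓ : ℕ) (s : ℕ → ℂ) (x : ℂ) :
    blochAnsatz τ η ζ κ ℓ s (x + τ / 2)
      = cexp (κ * (τ / (2 * η))) * cexp (-2 * Real.pi * I * ζ) * blochAnsatz τ η ζ κ ℓ s x := by
  rw [blochAnsatz, blochAnsatz, show κ * ((x + τ / 2) / η) = κ * (τ / (2 * η)) + κ * (x / η) by ring,
    Complex.exp_add]
  have h : ∑ j ∈ Finset.Icc 1 ℓ, s j * Phi τ (2 * (x + τ / 2) - 2 * j * η) ζ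
      = cexp (-2 * Real.pi * I * ζ) * ∑ j ∈ Finset.Icc 1 ℓ, s j * Phi τ (2 * x - 2 * j * η) ζ := by
    rw [Finset.mul_sum]
    refine Finset.sum_congr rfl fun j _ => ?_
    rw [show 2 * (x + τ / 2) - 2 * j * η = 2 * x - 2 * j * η + τ by ring, Phi_add_tau]
    ring
  rw [h]
  ring

lemma meromorphic_blochAnsatz (hτ : 0 < τ.im) (η ζ κ : ℂ) (ℓ : ℕ) (s : ℕ → ℂ) :
    Meromorphic (blochAnsatz τ η ζ κ ℓ s) := by
  have hθ (a b : ℂ) : Meromorphic fun x => theta1 τ (a * x + b) := fun x =>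
    ((differentiable_theta1 hτ).comp (f := fun x => a * x + b) (by fun_prop)).analyticAt x
      |>.meromorphicAt
  have he : Meromorphic fun x : ℂ => cexp (κ * (x / η)) := fun x =>
    (Differentiable.analyticAt (by fun_prop) x).meromorphicAt
  have hs (j : ℕ) : Meromorphic fun x => s j * Phi τ (2 * x - 2 * j * η) ζ := by
    have h := (Meromorphic.const (𝕜 := ℂ) (s j)).mul ((hθ 2 (ζ - 2 * j * η)).div
      ((hθ 2 (-(2 * j * η))).mul (Meromorphic.const (𝕜 := ℂ) (theta1 τ ζ))))
    refine h.congr_codiscrete (Eventually.of_forall fun x => ?_)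
    simp only [Pi.mul_apply, Pi.div_apply, Phi]
    ring_nf
  refine fun x => (he x).mul ?_
  exact MeromorphicAt.fun_sum fun j _ => hs j x

lemma isDoubleBloch_blochAnsatz (hτ : 0 < τ.im) (η ζ κ : ℂ) (ℓ : ℕ) (s : ℕ → ℂ) :
    IsDoubleBloch τ (cexp (κ * (1 / (2 * η))))
      (cexp (κ * (τ / (2 * η))) * cexp (-2 * Real.pi * I * ζ)) (blochAnsatz τ η ζ κ ℓ s) :=
  ⟨meromorphic_blochAnsatz hτ η ζ κ ℓ s,
    Eventually.of_forall (blochAnsatz_add_half τ η ζ κ ℓ s),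
    Eventually.of_forall (blochAnsatz_add_half_tau τ η ζ κ ℓ s)⟩

/-- The sum `∑_{j=1}^{ℓ} t_j θ₁(ζ - 2(j+p)η)/([j+p] θ₁(ζ))`. -/
noncomputable def poleSum (τ η ζ : ℂ) (ℓ p : ℕ) (t : ℕ → ℂ) : ℂ :=
  ∑ m ∈ Finset.range ℓ, t (m + 1)
    * (theta1 τ (ζ - 2 * (m + 1 + p : ℕ) * η) / (ellNum τ η (m + 1 + p : ℕ) * theta1 τ ζ))

/-- The value of the potential of the difference Lamé equation at `x = (j + 1)η`. -/
noncomputable def potentialValue (τ η : ℂ) (ℓ j : ℕ) : ℂ :=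
  ellNum τ η (j + 1 + ℓ) * ellNum τ η (j - ℓ) / (ellNum τ η (j + 1) * ellNum τ η j)

/-- The coefficient of `Φ(2x - 2iη, ζ)` in the difference Lamé equation for the ansatz. -/
noncomputable def residueCoeff (τ η ζ : ℂ) (ℓ : ℕ) (K E : ℂ) (t : ℕ → ℂ) (i : ℕ) : ℂ :=
  K * t (i + 1) + K⁻¹ * (potentialValue τ η ℓ (i - 1) * t (i - 1)) - E * t i
    + (if i = 1 then K⁻¹ * (ellNum τ η ℓ * ellNum τ η (ℓ + 1) / ellNum τ η 1)
        * poleSum τ η ζ ℓ 0 t else 0)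
    - (if i = 0 then K⁻¹ * (ellNum τ η ℓ * ellNum τ η (ℓ + 1) / ellNum τ η 1)
        * poleSum τ η ζ ℓ 1 t else 0)

/-- Here y stands for 2x. The shifts x ± η multiply the exponential by K^{±1} and move the index of
Φ by ∓1; the right side is regrouped by the functions Φ. -/
lemma sum_residueCoeff (hτ : 0 < τ.im) (hζ : theta1 τ ζ ≠ 0) (hℓ : 1 ≤ ℓ)
    (hη : ∀ j : ℕ, 1 ≤ j → j ≤ 2 * ℓ → ellNum τ η j ≠ 0) {t : ℕ → ℂ} (h₀ : t 0 = 0)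
    (ht : t (ℓ + 1) = 0) {y : ℂ}
    (hy : ∀ j ∈ Finset.range (ℓ + 2), theta1 τ (y - 2 * j * η) ≠ 0) :
    ∑ i ∈ Finset.range (ℓ + 1), residueCoeff τ η ζ ℓ K E t i * Phi τ (y - 2 * i * η) ζ
      = K * ∑ m ∈ Finset.range ℓ, t (m + 1) * Phi τ (y - 2 * m * η) ζ
        + theta1 τ (y + 2 * ℓ * η) * theta1 τ (y - 2 * (ℓ + 1) * η)
            / (theta1 τ y * theta1 τ (y - 2 * η))
          * (K⁻¹ * ∑ m ∈ Finset.range ℓ, t (m + 1) * Phi τ (y - 2 * (m + 2 : ℕ) * η) ζ)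
        - E * ∑ m ∈ Finset.range ℓ, t (m + 1) * Phi τ (y - 2 * (m + 1 : ℕ) * η) ζ := by
  set Q := ellNum τ η ℓ * ellNum τ η (ℓ + 1) / ellNum τ η 1 with hQ
  have hy₀ : theta1 τ y ≠ 0 := by simpa using hy 0 (by simp)
  have hy₁ : theta1 τ (y - 2 * η) ≠ 0 := by simpa using hy 1 (by simp)
  have hpot : theta1 τ (y + 2 * ℓ * η) * theta1 τ (y - 2 * (ℓ + 1) * η)
        / (theta1 τ y * theta1 τ (y - 2 * η))
        * ∑ m ∈ Finset.range ℓ, t (m + 1) * Phi τ (y - 2 * (m + 2 : ℕ) * η) ζ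
      = ∑ m ∈ Finset.range ℓ, potentialValue τ η ℓ (m + 1) * t (m + 1)
          * Phi τ (y - 2 * (m + 2 : ℕ) * η) ζ
        + Q * (poleSum τ η ζ ℓ 0 t * Phi τ (y - 2 * η) ζ - poleSum τ η ζ ℓ 1 t * Phi τ y ζ) := by
    rw [poleSum, poleSum, Finset.sum_mul, Finset.sum_mul, ← Finset.sum_sub_distrib,
      Finset.mul_sum, Finset.mul_sum, ← Finset.sum_add_distrib]
    refine Finset.sum_congr rfl fun m hm => ?_
    rw [Finset.mem_range] at hm
    have h := potential_mul_Phi (ℓ := ℓ) hτ hζ (j := m + 1) (y := y) (hη 1 le_rfl (by lia))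
      (hη (m + 1) (by lia) (by lia))
      (by exact_mod_cast hη (m + 1 + 1) (by lia) (by lia)) hy₀ hy₁
      (by exact_mod_cast hy (m + 1 + 1) (Finset.mem_range.2 (by lia)))
    rw [potentialValue]
    push_cast at h ⊢
    rw [show (m + 2 : ℂ) = m + 1 + 1 by ring, mul_left_comm, h]
    simp only [add_zero]
    ring
  have s₁ : ∑ i ∈ Finset.range (ℓ + 1), t (i + 1) * Phi τ (y - 2 * i * η) ζ
      = ∑ m ∈ Finset.range ℓ, t (m + 1) * Phi τ (y - 2 * m * η) ζ := by
    rw [Finset.sum_range_succ, ht, zero_mul, add_zero]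
  have s₂ : ∑ i ∈ Finset.range (ℓ + 1), t i * Phi τ (y - 2 * i * η) ζ
      = ∑ m ∈ Finset.range ℓ, t (m + 1) * Phi τ (y - 2 * (m + 1 : ℕ) * η) ζ := by
    rw [Finset.sum_range_succ', h₀, zero_mul, add_zero]
  have s₃ : ∑ i ∈ Finset.range (ℓ + 1), potentialValue τ η ℓ (i - 1) * t (i - 1)
        * Phi τ (y - 2 * i * η) ζ
      = ∑ m ∈ Finset.range ℓ, potentialValue τ η ℓ (m + 1) * t (m + 1)
          * Phi τ (y - 2 * (m + 2 : ℕ) * η) ζ := by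
    -- The potential vanishes at x = (ℓ+1)η, so no function Φ of index ℓ + 1 appears.
    have hlast : potentialValue τ η ℓ ℓ = 0 := by
      rw [potentialValue, sub_self, ellNum_zero hτ]
      simp
    have h := (Finset.sum_range_succ (fun m : ℕ => potentialValue τ η ℓ m * t m
      * Phi τ (y - 2 * (m + 1 : ℕ) * η) ζ) ℓ).symm.trans (Finset.sum_range_succ' _ ℓ)
    simp only [hlast, h₀, mul_zero, zero_mul, add_zero] at h
    rw [Finset.sum_range_succ']
    -- At i = 0 the truncated `i - 1` is 0, and `t 0 = 0` removes the term.
    simp only [add_tsub_cancel_right, zero_tsub, h₀, mul_zero, zero_mul, add_zero]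
    exact h
  have s₄ (c : ℂ) : ∑ i ∈ Finset.range (ℓ + 1), (if i = 1 then c else 0) * Phi τ (y - 2 * i * η) ζ
      = c * Phi τ (y - 2 * η) ζ := by
    rw [Finset.sum_eq_single_of_mem 1 (Finset.mem_range.2 (by lia)) fun i _ hi => by simp [hi]]
    simp
  have s₅ (c : ℂ) : ∑ i ∈ Finset.range (ℓ + 1), (if i = 0 then c else 0) * Phi τ (y - 2 * i * η) ζ
      = c * Phi τ y ζ := by
    rw [Finset.sum_eq_single_of_mem 0 (Finset.mem_range.2 (by lia)) fun i _ hi => by simp [hi]]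
    simp
  rw [mul_left_comm, hpot, ← s₁, ← s₂, ← s₃]
  simp only [residueCoeff, sub_mul, add_mul, Finset.sum_add_distrib, Finset.sum_sub_distrib, s₄, s₅]
  simp only [mul_assoc, ← Finset.mul_sum]
  ring

lemma eventually_theta1_sub_ne_zero (hτ : 0 < τ.im) (hζ : theta1 τ ζ ≠ 0) (η : ℂ) (n : ℕ) :
    ∀ᶠ x in codiscrete ℂ, ∀ j ∈ Finset.range n, theta1 τ (2 * x - 2 * j * η) ≠ 0 :=
  (eventually_all_finset _).2 fun j _ => by
    simpa [sub_eq_add_neg] using eventually_theta1_ne_zero hτ hζ (two_ne_zero' ℂ) (-(2 * j * η))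

lemma solvesLame_blochAnsatz_iff (hτ : 0 < τ.im) (hζ : theta1 τ ζ ≠ 0) (hℓ : 1 ≤ ℓ)
    (hη : ∀ j : ℕ, 1 ≤ j → j ≤ 2 * ℓ → ellNum τ η j ≠ 0) (hK : cexp κ = K) {t : ℕ → ℂ}
    (h₀ : t 0 = 0) (ht : t (ℓ + 1) = 0) :
    SolvesLame τ η ℓ E (blochAnsatz τ η ζ κ ℓ t)
      ↔ ∀ i ≤ ℓ, residueCoeff τ η ζ ℓ K E t i = 0 := by
  have hη₀ : η ≠ 0 := by
    rintro rfl
    exact hη 1 le_rfl (by lia) (by simp [ellNum, theta1_zero hτ])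
  have key : ∀ᶠ x in codiscrete ℂ,
      (blochAnsatz τ η ζ κ ℓ t (x + η)
        + theta1 τ (2 * x + 2 * ℓ * η) * theta1 τ (2 * x - 2 * (ℓ + 1) * η)
          / (theta1 τ (2 * x) * theta1 τ (2 * x - 2 * η)) * blochAnsatz τ η ζ κ ℓ t (x - η))
        - E * blochAnsatz τ η ζ κ ℓ t x
      = cexp (κ * (x / η)) * ∑ i ∈ Finset.range (ℓ + 1),
          residueCoeff τ η ζ ℓ K E t i * Phi τ (2 * x - 2 * i * η) ζ := by
    filter_upwards [eventually_theta1_sub_ne_zero hτ hζ η (ℓ + 2)] with x hx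
    rw [sum_residueCoeff hτ hζ hℓ hη h₀ ht hx]
    simp only [blochAnsatz, sum_Icc_one_eq_sum_range]
    rw [show κ * ((x + η) / η) = κ * (x / η) + κ by field_simp,
      show κ * ((x - η) / η) = κ * (x / η) + -κ by field_simp; ring, Complex.exp_add,
      Complex.exp_add, Complex.exp_neg, hK]
    have a₁ : ∑ m ∈ Finset.range ℓ, t (m + 1) * Phi τ (2 * (x + η) - 2 * (m + 1 : ℕ) * η) ζ
        = ∑ m ∈ Finset.range ℓ, t (m + 1) * Phi τ (2 * x - 2 * m * η) ζ :=
      Finset.sum_congr rfl fun m _ => by push_cast; ring_nf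
    have a₂ : ∑ m ∈ Finset.range ℓ, t (m + 1) * Phi τ (2 * (x - η) - 2 * (m + 1 : ℕ) * η) ζ
        = ∑ m ∈ Finset.range ℓ, t (m + 1) * Phi τ (2 * x - 2 * (m + 2 : ℕ) * η) ζ :=
      Finset.sum_congr rfl fun m _ => by push_cast; ring_nf
    rw [a₁, a₂]
    ring
  constructor
  · intro h i hi
    refine eq_zero_of_sum_Phi hτ hζ (fun j h₁ h₂ => hη j h₁ (by lia)) ?_ hi
    filter_upwards [key, h] with x hx hs
    rw [hs, sub_self] at hx
    exact (mul_eq_zero.1 hx.symm).resolve_left (Complex.exp_ne_zero _)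
  · intro h
    filter_upwards [key] with x hx
    rw [Finset.sum_eq_zero fun i hi => by
      rw [h i (Nat.lt_succ_iff.1 (Finset.mem_range.1 hi)), zero_mul], mul_zero] at hx
    exact sub_eq_zero.1 hx

lemma blochAnsatz_coeff_eq_zero (hτ : 0 < τ.im) (hζ : theta1 τ ζ ≠ 0)
    (hη : ∀ j : ℕ, 1 ≤ j → j ≤ 2 * ℓ → ellNum τ η j ≠ 0) {t : ℕ → ℂ} (h₀ : t 0 = 0)
    (h : blochAnsatz τ η ζ κ ℓ t =ᶠ[codiscrete ℂ] 0) {i : ℕ} (hi : i ≤ ℓ) : t i = 0 := by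
  refine eq_zero_of_sum_Phi hτ hζ (fun j h₁ h₂ => hη j h₁ (by lia)) ?_ hi
  filter_upwards [h] with x hx
  rw [Finset.sum_range_succ', h₀, zero_mul, add_zero, ← sum_Icc_one_eq_sum_range
    (fun j => t j * Phi τ (2 * x - 2 * j * η) ζ)]
  exact (mul_eq_zero.1 hx).resolve_left (Complex.exp_ne_zero _)

end Ansatz

/-! ### Solution of the linear system and the spectral curve -/

section SpectralCurve

variable {τ η ζ κ K E : ℂ} {ℓ : ℕ}

lemma ellBinom_zero {n : ℕ} (hη : ∀ j : ℕ, 1 ≤ j → j ≤ n → ellNum τ η j ≠ 0) :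
    ellBinom τ η n 0 = 1 := by
  have := ellFactorial_ne_zero hη le_rfl
  rw [ellBinom, ellFactorial_zero, Nat.sub_zero, one_mul, div_self this]

lemma ellNum_mul_ellBinom_succ {n k : ℕ} (hη : ∀ j : ℕ, 1 ≤ j → j ≤ n → ellNum τ η j ≠ 0)
    (hk : k < n) :
    ellNum τ η (k + 1) * ellBinom τ η n (k + 1) = ellNum τ η (n - k) * ellBinom τ η n k := by
  obtain ⟨m, rfl⟩ : ∃ m, n = m + k + 1 := ⟨n - k - 1, by lia⟩
  have h₁ := ellFactorial_succ τ η m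
  have h₂ := ellFactorial_succ τ η k
  have h₅ := ellFactorial_ne_zero hη (n := m + 1) (by lia)
  have h₆ := ellFactorial_ne_zero hη (n := k + 1) (by lia)
  rw [ellBinom, ellBinom, show m + k + 1 - (k + 1) = m by lia, show m + k + 1 - k = m + 1 by lia,
    show ((m + k + 1 : ℕ) - k : ℤ) = m + 1 by push_cast; ring]
  rw [h₁] at h₅ ⊢
  rw [h₂] at h₆ ⊢
  have := left_ne_zero_of_mul h₅
  have := right_ne_zero_of_mul h₅
  have := left_ne_zero_of_mul h₆
  have := right_ne_zero_of_mul h₆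
  field_simp

lemma ellNum_mul_ellBinom_succ_succ {n k : ℕ} (hη : ∀ j : ℕ, 1 ≤ j → j ≤ n → ellNum τ η j ≠ 0)
    (hk : k ≤ n) (hk' : ellNum τ η (k + 1) ≠ 0) :
    ellNum τ η (k + 1) * ellBinom τ η (n + 1) (k + 1)
      = ellNum τ η (n + 1) * ellBinom τ η n k := by
  have h₆ := ellFactorial_ne_zero hη (n := k) (by lia)
  have h₇ := ellFactorial_ne_zero hη (n := n - k) (by lia)
  rw [ellBinom, ellBinom, show n + 1 - (k + 1) = n - k by lia, ellFactorial_succ, ellFactorial_succ]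
  field_simp

/-- The coefficients of the solution of the difference Lamé equation, up to a common factor. -/
noncomputable def solCoeff (τ η : ℂ) (ℓ : ℕ) (K E : ℂ) (j : ℕ) : ℂ :=
  if j ≤ ℓ then (-1) ^ j * (K ^ j)⁻¹ * ellNum τ η j * ellBinom τ η ℓ j
    * (lamePoly τ η ℓ j).eval E else 0

lemma solCoeff_zero (hτ : 0 < τ.im) : solCoeff τ η ℓ K E 0 = 0 := by
  simp [solCoeff, ellNum_zero hτ]

lemma solCoeff_self_add_one : solCoeff τ η ℓ K E (ℓ + 1) = 0 :=
  if_neg (by lia)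

lemma solCoeff_self_ne_zero (hK : K ≠ 0) (hℓ : 1 ≤ ℓ)
    (hη : ∀ j : ℕ, 1 ≤ j → j ≤ 2 * ℓ → ellNum τ η j ≠ 0) : solCoeff τ η ℓ K E ℓ ≠ 0 := by
  have h {n : ℕ} (hn : n ≤ 2 * ℓ) := ellFactorial_ne_zero hη hn
  rw [solCoeff, if_pos le_rfl, lamePoly_self hη, eval_one, mul_one]
  refine mul_ne_zero (mul_ne_zero (mul_ne_zero (pow_ne_zero _ (by norm_num))
    (inv_ne_zero (pow_ne_zero _ hK))) (hη ℓ hℓ (by lia))) ?_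
  rw [ellBinom]
  exact div_ne_zero (h (by lia)) (mul_ne_zero (h (by lia)) (h (by lia)))

/-- The next coefficient of the solution, in terms of binomials of the current index. -/
lemma mul_solCoeff_succ (hτ : 0 < τ.im) (hK : K ≠ 0)
    (hη : ∀ j : ℕ, 1 ≤ j → j ≤ 2 * ℓ → ellNum τ η j ≠ 0) {i : ℕ} (hi : i ≤ ℓ) :
    K * solCoeff τ η ℓ K E (i + 1) = (-1) ^ i * (K ^ i)⁻¹ * ellBinom τ η ℓ i
      * (ellNum τ η (i - ℓ) * (lamePoly τ η ℓ (i + 1)).eval E) := by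
  rcases hi.lt_or_eq with h | rfl
  · have hb := ellNum_mul_ellBinom_succ (fun j h₁ h₂ => hη j h₁ (by lia)) h
    rw [solCoeff, if_pos (by lia), show (i - ℓ : ℤ) = -(ℓ - i) by ring, ellNum_neg hτ]
    push_cast
    rw [pow_succ, pow_succ, mul_inv]
    have : K * K⁻¹ = 1 := mul_inv_cancel₀ hK
    linear_combination -(-1) ^ i * (K ^ i)⁻¹ * (lamePoly τ η ℓ (i + 1)).eval E * hb
      - (-1) ^ i * (K ^ i)⁻¹ * ellNum τ η (i + 1) * ellBinom τ η ℓ (i + 1)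
        * (lamePoly τ η ℓ (i + 1)).eval E * this
  · rw [solCoeff_self_add_one, sub_self, ellNum_zero hτ]
    simp

lemma eval_lamePoly_recurrence (hτ : 0 < τ.im)
    (hη : ∀ j : ℕ, 1 ≤ j → j ≤ 2 * ℓ → ellNum τ η j ≠ 0) {j : ℤ} (hj : |j| ≤ ℓ) (E : ℂ) :
    ellNum τ η j * E * (lamePoly τ η ℓ j).eval E
      = ellNum τ η (j + ℓ) * (lamePoly τ η ℓ (j - 1)).eval E
        + ellNum τ η (j - ℓ) * (lamePoly τ η ℓ (j + 1)).eval E := by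
  simpa using congrArg (eval E) (lamePoly_recurrence hτ hη hj)

lemma potentialValue_mul_solCoeff (hτ : 0 < τ.im)
    (hη : ∀ j : ℕ, 1 ≤ j → j ≤ 2 * ℓ → ellNum τ η j ≠ 0) (hK : K ≠ 0) {i : ℕ} (hi₁ : 1 ≤ i)
    (hi : i < ℓ) :
    K⁻¹ * (potentialValue τ η ℓ i * solCoeff τ η ℓ K E i)
      = (-1) ^ (i + 1) * (K ^ (i + 1))⁻¹ * ellBinom τ η ℓ (i + 1)
        * (ellNum τ η (i + 1 + ℓ) * (lamePoly τ η ℓ i).eval E) := by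
  have hb := ellNum_mul_ellBinom_succ (fun j h₁ h₂ => hη j h₁ (by lia)) hi
  have h₁ := hη i hi₁ (by lia)
  have h₂ := hη (i + 1) (by lia) (by lia)
  rw [Nat.cast_add, Nat.cast_one] at h₂
  rw [solCoeff, if_pos hi.le, potentialValue, show (i - ℓ : ℤ) = -(ℓ - i) by ring, ellNum_neg hτ]
  field_simp
  rw [pow_succ]
  linear_combination (-1) ^ i * K * K ^ i * ellNum τ η (i + 1 + ℓ)
    * (lamePoly τ η ℓ i).eval E * hb

/-- With all three coefficients written through the binomial of index i, the factor (-1)^i K^{-i} [ℓ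
over i] comes out and the recurrence of `lamePoly` at i remains. -/
lemma residueCoeff_solCoeff (hτ : 0 < τ.im)
    (hη : ∀ j : ℕ, 1 ≤ j → j ≤ 2 * ℓ → ellNum τ η j ≠ 0) (hK : K ≠ 0) {i : ℕ} (hi₂ : 2 ≤ i)
    (hi : i ≤ ℓ) : residueCoeff τ η ζ ℓ K E (solCoeff τ η ℓ K E) i = 0 := by
  obtain ⟨i, rfl⟩ : ∃ m, i = m + 1 := ⟨i - 1, by lia⟩
  have hr := eval_lamePoly_recurrence hτ hη (j := i + 1) (abs_le.2 ⟨by lia, by lia⟩) E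
  rw [residueCoeff, if_neg (by lia), if_neg (by lia), Nat.add_sub_cancel,
    potentialValue_mul_solCoeff hτ hη hK (by lia) (by lia), mul_solCoeff_succ hτ hK hη hi,
    solCoeff, if_pos hi]
  rw [add_sub_cancel_right] at hr
  push_cast
  linear_combination -(-1) ^ (i + 1) * (K ^ (i + 1))⁻¹ * ellBinom τ η ℓ (i + 1) * hr

/-- The pole sum supplies the terms j ≥ 1. The recurrence at index 1, whose term with A_0(E) has no
counterpart among the coefficients, supplies j = 0. -/
lemma residueCoeff_solCoeff_one (hτ : 0 < τ.im) (hζ : theta1 τ ζ ≠ 0) (hℓ : 1 ≤ ℓ)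
    (hη : ∀ j : ℕ, 1 ≤ j → j ≤ 2 * ℓ → ellNum τ η j ≠ 0) (hK : K ≠ 0) :
    residueCoeff τ η ζ ℓ K E (solCoeff τ η ℓ K E) 1
      = K⁻¹ * (ellNum τ η ℓ * ellNum τ η (ℓ + 1) / (ellNum τ η 1 * theta1 τ ζ))
        * ∑ j ∈ Finset.range (ℓ + 1), (-1) ^ j * (K ^ j)⁻¹ * theta1 τ (ζ - 2 * j * η)
            * ellBinom τ η ℓ j * (lamePoly τ η ℓ j).eval E := by
  have hη' : ∀ j : ℕ, 1 ≤ j → j ≤ ℓ → ellNum τ η j ≠ 0 := fun j h₁ h₂ => hη j h₁ (by lia)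
  have hr := eval_lamePoly_recurrence hτ hη (j := 1) (abs_le.2 ⟨by lia, by lia⟩) E
  have hb := ellNum_mul_ellBinom_succ hη' (k := 0) (by lia)
  have h₁ : ellNum τ η 1 ≠ 0 := by exact_mod_cast hη 1 le_rfl (by lia)
  have hp : poleSum τ η ζ ℓ 0 (solCoeff τ η ℓ K E) * theta1 τ ζ
      = ∑ m ∈ Finset.range ℓ, (-1) ^ (m + 1) * (K ^ (m + 1))⁻¹
        * theta1 τ (ζ - 2 * (m + 1 : ℕ) * η)
        * ellBinom τ η ℓ (m + 1) * (lamePoly τ η ℓ (m + 1 : ℕ)).eval E := by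
    rw [poleSum, Finset.sum_mul]
    refine Finset.sum_congr rfl fun m hm => ?_
    rw [Finset.mem_range] at hm
    have := hη' (m + 1) (by lia) (by lia)
    rw [solCoeff, if_pos (by lia), add_zero]
    generalize ellNum τ η (m + 1 : ℕ) = c at this ⊢
    generalize theta1 τ (ζ - 2 * (m + 1 : ℕ) * η) = d
    field_simp
  rw [Finset.sum_range_succ', ← hp, residueCoeff, if_pos rfl, if_neg one_ne_zero,
    mul_solCoeff_succ hτ hK hη hℓ, Nat.sub_self, solCoeff_zero hτ, ellBinom_zero hη', solCoeff,
    if_pos hℓ]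
  rw [ellBinom_zero hη'] at hb
  simp only [Nat.cast_zero, Nat.cast_one, zero_add, sub_zero, mul_one, pow_zero, inv_one, mul_zero,
    zero_mul, pow_one, sub_self] at hb hr ⊢
  rw [add_comm (1 : ℤ) ℓ] at hr
  field_simp
  linear_combination ellNum τ η 1 * ellBinom τ η ℓ 1 * hr
    + ellNum τ η (ℓ + 1) * (lamePoly τ η ℓ 0).eval E * hb

/-- The term j = 0 is K times the first coefficient, by A_{-η}(E) = A_η(E); the term j = 1 contains
θ₁(0) = 0; the terms j ≥ 2 are the second pole sum. -/
lemma residueCoeff_solCoeff_zero (hτ : 0 < τ.im) (hζ : theta1 τ ζ ≠ 0) (hℓ : 1 ≤ ℓ)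
    (hη : ∀ j : ℕ, 1 ≤ j → j ≤ 2 * ℓ → ellNum τ η j ≠ 0) (hK : K ≠ 0) :
    residueCoeff τ η ζ ℓ K E (solCoeff τ η ℓ K E) 0
      = ellNum τ η ℓ / (ellNum τ η 1 * theta1 τ ζ)
        * ∑ j ∈ Finset.range (ℓ + 2), (-1) ^ j * (K ^ j)⁻¹ * theta1 τ (ζ - 2 * j * η)
            * theta1 τ (2 * ((j : ℂ) - 1) * η) * ellBinom τ η (ℓ + 1) j
            * (lamePoly τ η ℓ ((j : ℤ) - 1)).eval E := by
  have hη' : ∀ j : ℕ, 1 ≤ j → j ≤ ℓ → ellNum τ η j ≠ 0 := fun j h₁ h₂ => hη j h₁ (by lia)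
  have h₁ : ellNum τ η 1 ≠ 0 := by exact_mod_cast hη 1 le_rfl (by lia)
  have hp : -(K⁻¹ * ellNum τ η (ℓ + 1) * (poleSum τ η ζ ℓ 1 (solCoeff τ η ℓ K E) * theta1 τ ζ))
      = ∑ m ∈ Finset.range ℓ, (-1) ^ (m + 1 + 1) * (K ^ (m + 1 + 1))⁻¹
        * theta1 τ (ζ - 2 * (m + 1 + 1 : ℕ) * η)
        * theta1 τ (2 * (((m + 1 + 1 : ℕ) : ℂ) - 1) * η)
        * ellBinom τ η (ℓ + 1) (m + 1 + 1)
        * (lamePoly τ η ℓ (((m + 1 + 1 : ℕ) : ℤ) - 1)).eval E := by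
    rw [poleSum, Finset.sum_mul, Finset.mul_sum, ← Finset.sum_neg_distrib]
    refine Finset.sum_congr rfl fun m hm => ?_
    rw [Finset.mem_range] at hm
    have hm₂ := hη (m + 1 + 1) (by lia) (by lia)
    have hb : ellNum τ η (m + 1 + 1 : ℕ) * ellBinom τ η (ℓ + 1) (m + 1 + 1)
        = ellNum τ η (ℓ + 1) * ellBinom τ η ℓ (m + 1) := by
      rw [Nat.cast_succ (m + 1)] at hm₂ ⊢
      exact ellNum_mul_ellBinom_succ_succ hη' (by lia) hm₂
    rw [solCoeff, if_pos (by lia), show ((m + 1 + 1 : ℕ) : ℤ) - 1 = (m + 1 : ℕ) by lia,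
      show 2 * (((m + 1 + 1 : ℕ) : ℂ) - 1) * η = 2 * ((m + 1 : ℕ) : ℂ) * η by push_cast; ring,
      ← ellNum_natCast]
    generalize ellNum τ η (m + 1 + 1 : ℕ) = c at hm₂ hb ⊢
    generalize theta1 τ (ζ - 2 * (m + 1 + 1 : ℕ) * η) = d
    generalize ellNum τ η (m + 1 : ℕ) = f
    field_simp
    rw [pow_succ _ (m + 1)]
    linear_combination -f * (lamePoly τ η ℓ (m + 1 : ℕ)).eval E * d * K ^ 2 * K ^ m * (-1) ^ m * hb
  have hb := ellNum_mul_ellBinom_succ hη' (k := 0) (by lia)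
  have hfac : ellBinom τ η (ℓ + 1) 0 = 1 := ellBinom_zero fun j h₁ h₂ => hη j h₁ (by lia)
  rw [Finset.sum_range_succ', Finset.sum_range_succ', ← hp, residueCoeff, if_pos rfl,
    if_neg zero_ne_one, mul_solCoeff_succ hτ hK hη (by lia), Nat.zero_sub, solCoeff_zero hτ,
    ellBinom_zero hη', hfac]
  have e₁ : theta1 τ (2 * (((0 : ℕ) : ℂ) - 1) * η) = -ellNum τ η 1 := by
    rw [← ellNum_neg hτ, ellNum]; push_cast; ring_nf
  have e₂ : theta1 τ (2 * (((0 + 1 : ℕ) : ℂ) - 1) * η) = 0 := by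
    simp [theta1_zero hτ]
  rw [e₁, e₂, Nat.cast_zero, zero_sub, ellNum_neg hτ, show (0 - 1 : ℤ) = -1 by rfl, lamePoly_neg]
  simp only [Nat.cast_zero, zero_add, sub_zero, mul_one, pow_zero, inv_one, mul_zero,
    zero_mul, add_zero]
  field_simp
  ring

/-- The equations of index 2 to ℓ determine t downwards from `t (ℓ + 1) = 0` and `t ℓ`, because the
potential values of index 1 to ℓ - 1, by which one divides, are nonzero. -/
lemma eq_smul_solCoeff (hτ : 0 < τ.im) (hℓ : 1 ≤ ℓ)
    (hη : ∀ j : ℕ, 1 ≤ j → j ≤ 2 * ℓ → ellNum τ η j ≠ 0) (hK : K ≠ 0) {t : ℕ → ℂ} (h₀ : t 0 = 0)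
    (ht : t (ℓ + 1) = 0) (h : ∀ i, 2 ≤ i → i ≤ ℓ → residueCoeff τ η ζ ℓ K E t i = 0) {i : ℕ}
    (hi : i ≤ ℓ + 1) :
    t i = t ℓ / solCoeff τ η ℓ K E ℓ * solCoeff τ η ℓ K E i := by
  have hne := solCoeff_self_ne_zero (E := E) hK hℓ hη
  rcases i.eq_zero_or_pos with rfl | hi₀
  · rw [h₀, solCoeff_zero hτ, mul_zero]
  have H : ∀ n ≤ ℓ, t (ℓ + 1 - n)
      = t ℓ / solCoeff τ η ℓ K E ℓ * solCoeff τ η ℓ K E (ℓ + 1 - n) := by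
    intro n
    induction n using Nat.twoStepInduction with
    | zero => simp [ht, solCoeff_self_add_one]
    | one => simp [div_mul_cancel₀ _ hne]
    | more n ih₀ ih₁ =>
      intro hn
      obtain ⟨m, hm⟩ : ∃ m, ℓ = n + 2 + m := ⟨ℓ - n - 2, by lia⟩
      have ih₀ := ih₀ (by lia)
      have ih₁ := ih₁ (by lia)
      rw [show ℓ + 1 - n = m + 3 by lia] at ih₀
      rw [show ℓ + 1 - (n + 1) = m + 2 by lia] at ih₁
      rw [show ℓ + 1 - (n + 2) = m + 1 by lia]
      have r₁ := h (m + 2) (by lia) (by lia)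
      have r₂ := residueCoeff_solCoeff (ζ := ζ) (E := E) hτ hη hK (i := m + 2) (by lia) (by lia)
      simp only [residueCoeff, show m + 2 ≠ 1 by lia, show m + 2 ≠ 0 by lia, if_false,
        show m + 2 + 1 = m + 3 by lia, show m + 2 - 1 = m + 1 by lia] at r₁ r₂
      have hpot : K⁻¹ * potentialValue τ η ℓ (m + 1) ≠ 0 := by
        have g₁ := hη (m + 1) (by lia) (by lia)
        have g₂ := hη (m + 1 + 1) (by lia) (by lia)
        have g₃ := hη (m + 1 + 1 + ℓ) (by lia) (by lia)
        have g₄ := hη (n + 1) (by lia) (by lia)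
        rw [potentialValue, show ((m + 1 : ℕ) - ℓ : ℤ) = -(n + 1 : ℕ) by lia, ellNum_neg hτ]
        exact mul_ne_zero (inv_ne_zero hK) (div_ne_zero (mul_ne_zero (by exact_mod_cast g₃)
          (neg_ne_zero.2 g₄)) (mul_ne_zero (by exact_mod_cast g₂) g₁))
      refine mul_left_cancel₀ hpot ?_
      rw [ih₀, ih₁] at r₁
      linear_combination r₁ - t ℓ / solCoeff τ η ℓ K E ℓ * r₂
  have := H (ℓ + 1 - i) (by lia)
  rwa [show ℓ + 1 - (ℓ + 1 - i) = i by lia] at this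

lemma residueCoeff_congr_smul (hℓ : 1 ≤ ℓ) {t u : ℕ → ℂ} {c : ℂ}
    (h : ∀ i ≤ ℓ + 1, t i = c * u i) {i : ℕ} (hi : i ≤ ℓ) :
    residueCoeff τ η ζ ℓ K E t i = c * residueCoeff τ η ζ ℓ K E u i := by
  have hp (p : ℕ) : poleSum τ η ζ ℓ p t = c * poleSum τ η ζ ℓ p u := by
    rw [poleSum, poleSum, Finset.mul_sum]
    refine Finset.sum_congr rfl fun m hm => ?_
    rw [Finset.mem_range] at hm
    rw [h (m + 1) (by lia), mul_assoc]
  rw [residueCoeff, residueCoeff, h (i + 1) (by lia), h (i - 1) (by lia), h i (by lia), hp, hp]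
  split_ifs <;> ring

/-- The difference Lamé equation has a nontrivial double-Bloch solution exactly on the curve. -/
lemma exists_doubleBloch_iff (hτ : 0 < τ.im) (hζ : theta1 τ ζ ≠ 0) (hℓ : 1 ≤ ℓ)
    (hη : ∀ j : ℕ, 1 ≤ j → j ≤ 2 * ℓ → ellNum τ η j ≠ 0) (hK : cexp κ = K) :
    (∃ (s : ℕ → ℂ) (ψ : ℂ → ℂ), ψ = blochAnsatz τ η ζ κ ℓ s ∧
        ¬ (ψ =ᶠ[codiscrete ℂ] 0) ∧
        IsDoubleBloch τ (cexp (κ * (1 / (2 * η))))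
          (cexp (κ * (τ / (2 * η))) * cexp (-2 * Real.pi * I * ζ)) ψ ∧
        SolvesLame τ η ℓ E ψ) ↔
      (∑ j ∈ Finset.range (ℓ + 1), (-1) ^ j * (K ^ j)⁻¹ * theta1 τ (ζ - 2 * j * η)
          * ellBinom τ η ℓ j * (lamePoly τ η ℓ j).eval E = 0 ∧
        ∑ j ∈ Finset.range (ℓ + 2), (-1) ^ j * (K ^ j)⁻¹ * theta1 τ (ζ - 2 * j * η)
          * theta1 τ (2 * ((j : ℂ) - 1) * η) * ellBinom τ η (ℓ + 1) j
          * (lamePoly τ η ℓ ((j : ℤ) - 1)).eval E = 0) := by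
  have hK₀ : K ≠ 0 := hK ▸ Complex.exp_ne_zero κ
  have hN₁ : ellNum τ η 1 ≠ 0 := by exact_mod_cast hη 1 le_rfl (by lia)
  have hNℓ : ellNum τ η ℓ ≠ 0 := hη ℓ hℓ (by lia)
  have hNℓ' : ellNum τ η (ℓ + 1) ≠ 0 := by exact_mod_cast hη (ℓ + 1) (by lia) (by lia)
  have r₁ := residueCoeff_solCoeff_one (E := E) hτ hζ hℓ hη hK₀
  have r₀ := residueCoeff_solCoeff_zero (E := E) hτ hζ hℓ hη hK₀
  constructor
  · rintro ⟨s, ψ, rfl, hne, -, hs⟩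
    -- The ansatz only sees s_1, ..., s_ℓ; resetting the other values provides the boundary
    -- conditions at 0 and ℓ + 1.
    set t : ℕ → ℂ := fun j => if 1 ≤ j ∧ j ≤ ℓ then s j else 0 with ht
    have hst : blochAnsatz τ η ζ κ ℓ s = blochAnsatz τ η ζ κ ℓ t := by
      ext x
      rw [blochAnsatz, blochAnsatz]
      congr 1
      refine Finset.sum_congr rfl fun j hj => ?_
      rw [Finset.mem_Icc] at hj
      simp only [ht, if_pos hj]
    rw [hst] at hne hs
    have ht₀ : t 0 = 0 := if_neg (by lia)
    have ht₁ : t (ℓ + 1) = 0 := if_neg (by lia)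
    rw [solvesLame_blochAnsatz_iff hτ hζ hℓ hη hK ht₀ ht₁] at hs
    have hprop := fun i (hi : i ≤ ℓ + 1) =>
      eq_smul_solCoeff hτ hℓ hη hK₀ ht₀ ht₁ (fun i _ hi => hs i hi) hi
    have hc : t ℓ / solCoeff τ η ℓ K E ℓ ≠ 0 := by
      intro hc
      refine hne (Eventually.of_forall fun x => ?_)
      rw [blochAnsatz, Finset.sum_eq_zero, mul_zero, Pi.zero_apply]
      intro j hj
      rw [Finset.mem_Icc] at hj
      rw [hprop j (by lia), hc, zero_mul, zero_mul]
    have h₁ := hs 1 hℓ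
    have h₀ := hs 0 (by lia)
    rw [residueCoeff_congr_smul hℓ hprop (by lia)] at h₁ h₀
    have h₁ := (mul_eq_zero.1 h₁).resolve_left hc
    have h₀ := (mul_eq_zero.1 h₀).resolve_left hc
    rw [r₁] at h₁
    rw [r₀] at h₀
    exact ⟨(mul_eq_zero.1 h₁).resolve_left (mul_ne_zero (inv_ne_zero hK₀)
      (div_ne_zero (mul_ne_zero hNℓ hNℓ') (mul_ne_zero hN₁ hζ))),
      (mul_eq_zero.1 h₀).resolve_left (div_ne_zero hNℓ (mul_ne_zero hN₁ hζ))⟩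
  · rintro ⟨h₁, h₀⟩
    refine ⟨solCoeff τ η ℓ K E, _, rfl, fun h => ?_, isDoubleBloch_blochAnsatz hτ _ _ _ _ _, ?_⟩
    -- The solution is nontrivial for every E because A_{ℓη}(E) = 1 makes its last coefficient
    -- nonzero.
    · exact solCoeff_self_ne_zero hK₀ hℓ hη
        (blochAnsatz_coeff_eq_zero hτ hζ hη (solCoeff_zero hτ) h le_rfl)
    · rw [solvesLame_blochAnsatz_iff hτ hζ hℓ hη hK (solCoeff_zero hτ) solCoeff_self_add_one]
      intro i hi
      rcases Nat.lt_or_ge i 2 with h | h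
      · interval_cases i
        · rw [r₀, h₀, mul_zero]
        · rw [r₁, h₁, mul_zero]
      · exact residueCoeff_solCoeff hτ hη hK₀ h hi

end SpectralCurve

end DifferenceLame

theorem theorem3p1 (τ η : ℂ) (hτ : 0 < τ.im) (ℓ : ℕ) (hℓ : 1 ≤ ℓ)
    (hη : ∀ j : ℕ, 1 ≤ j → j ≤ 2 * ℓ → theta1 τ (2 * j * η) ≠ 0) :
    -- nontrivial double-Bloch solutions exist exactly on the curve
    (∀ ζ K E κ : ℂ, theta1 τ ζ ≠ 0 → Complex.exp κ = K →
      ((∃ (s : ℕ → ℂ) (ψ : ℂ → ℂ), ψ = blochAnsatz τ η ζ κ ℓ s ∧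
          ¬ (ψ =ᶠ[codiscrete ℂ] 0) ∧
          IsDoubleBloch τ (Complex.exp (κ * (1 / (2 * η))))
            (Complex.exp (κ * (τ / (2 * η))) * Complex.exp (-2 * Real.pi * Complex.I * ζ)) ψ ∧
          SolvesLame τ η ℓ E ψ) ↔
        (∑ j ∈ Finset.range (ℓ + 1), (-1) ^ j * (K ^ j)⁻¹ * theta1 τ (ζ - 2 * j * η)
            * ellBinom τ η ℓ j * (lamePoly τ η ℓ j).eval E = 0 ∧
          ∑ j ∈ Finset.range (ℓ + 2), (-1) ^ j * (K ^ j)⁻¹ * theta1 τ (ζ - 2 * j * η)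
            * theta1 τ (2 * ((j : ℂ) - 1) * η) * ellBinom τ η (ℓ + 1) j
            * (lamePoly τ η ℓ ((j : ℤ) - 1)).eval E = 0))) ∧
    -- the polynomials have degree `ℓ - |j|`
    (∀ j : ℤ, |j| ≤ (ℓ : ℤ) →
      (lamePoly τ η ℓ j).degree = ((ℓ - j.natAbs : ℕ) : WithBot ℕ)) ∧
    -- the operators `A_{jη}` commute
    (∀ i j : ℤ, |i| ≤ (ℓ : ℤ) → |j| ≤ (ℓ : ℤ) → ∀ F : ℂ → ℂ,
      opA τ η ℓ (i * η) (opA τ η ℓ (j * η) F)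
        =ᶠ[codiscrete ℂ] opA τ η ℓ (j * η) (opA τ η ℓ (i * η) F)) ∧
    -- the values `A_{jη}(E)` are their eigenvalues on eigenfunctions of `L`
    (∀ j : ℤ, |j| ≤ (ℓ : ℤ) → ∀ (E : ℂ) (Ψ : ℂ → ℂ),
      lameOp τ η ℓ Ψ =ᶠ[codiscrete ℂ] (fun x => E * Ψ x) →
      opA τ η ℓ (j * η) Ψ =ᶠ[codiscrete ℂ] (fun x => (lamePoly τ η ℓ j).eval E * Ψ x)) := by
  have hη' : ∀ j : ℕ, 1 ≤ j → j ≤ 2 * ℓ → ellNum τ η j ≠ 0 := fun j h₁ h₂ => by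
    rw [ellNum_natCast]
    exact hη j h₁ h₂
  exact ⟨fun ζ K E κ hζ hK => exists_doubleBloch_iff hτ hζ hℓ hη' hK,
    fun j _ => degree_lamePoly hη' j,
    fun i j hi hj F => opA_commute hτ hℓ hη' hi hj F,
    fun j hj E Ψ hΨ => opA_eigenvalue hτ hℓ hη' hj hΨ⟩
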